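/- For a prime power $q$ let $N:\mathbb{F}_{q^3}\to\mathbb{F}_q$, $N(X)=X\cdot X^q\cdot X^{q^2}$, be the norm. The projective norm graph $\mathrm{NG}(q,4)$ is the graph with vertex set $\mathbb{F}_{q^3}\times\mathbb{F}_q^*$ in which two distinct vertices $(A,a)$ and $(B,b)$ are adjacent if and only if $N(A+B)=ab$. Theorem. Let $q=p^k$ with $p$ a prime, $p\neq 2,3$, and $k\geq 1$. Then $\mathrm{NG}(q,4)$ contains at least $(q^3-1)(q-1)(q^3-24)$ copies of $K_{4,6}$, that is, at least that many different subgraphs isomorphic to the complete bipartite graph $K_{4,6}$. Moreover $(q^3-1)(q-1)(q^3-24)=(1+o(1))q^7$ as $q\to\infty$. -/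

import Mathlib

/-- The projective norm graph of an extension `L / K` of finite fields. If `K` has `q` elements and
`L` has degree `t - 1` over `K`, this is the graph `NG(q, t)`: the vertices are the pairs `(A, a)`
with `A ∈ L = 𝔽_{q^{t-1}}` and `a ∈ Kˣ = 𝔽_q^*`, and two distinct vertices `(A, a)` and `(B, b)`
are adjacent if and only if `N(A + B) = a * b`, where `N : L → K` is the field norm
`N(X) = X * X^q * ⋯ * X^(q^(t-2))`. -/
def projectiveNormGraph (K L : Type*) [Field K] [Field L] [Algebra K L] :
    SimpleGraph (L × Kˣ) where
  Adj u v := u ≠ v ∧ Algebra.norm K (u.1 + v.1) = (u.2 : K) * (v.2 : K)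
  symm := ⟨fun u v h => ⟨h.1.symm, by rw [add_comm, h.2, mul_comm]⟩⟩
  loopless := ⟨fun _ h => h.1 rfl⟩

/-! One suitable solution of `N (α i + β j) = a i * b j`, with four `α i` and six `β j`, suffices.
Dilating by `c`, translating the two sides by `T` and `-T`, and scaling second coordinates by `l`
preserves the equations. There are `q^3 - 1` choices of `c`, `q - 1` of `l`, and at least `q^3 - 24`
of `T`, since each of the 24 pairs forbids one `T`. These copies are different subgraphs if `3 ∑ α +
2 ∑ β ≠ 0`.

Inversion `x ↦ 1 / (x - e)` reduces the problem to three `v i` and six `b j` with `N (b j - v i)`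
independent of `j`; the fourth left vertex is the image of infinity, and `e` is free to make the
weighted sum nonzero.

Take for the `v i` the roots of an irreducible "simplest cubic" `f = X^3 - a X^2 + (a - 3) X + 1`,
permuted cyclically by `ρ x = 1 / (1 - x)`. For `x` in the base field `N (x - v i) = f x`. If an
involution `m` in `PGL₂(K)` satisfies `m ρ m = ρ⁻¹`, then `N (m (v k) - v i)` is also one constant,
for all `k` and `i`. So six `b j` arise when that constant is a value taken by `f` at three points
of `K`: the `m (v k)` and these points.

It remains to find `a` with `f` irreducible and `(2 a - 3) f(x) = a^2 - 3 a + 9` solvable by three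
`x` in `K`. In the coordinate `(x + ω) / (x + ω^2)`, which diagonalises `ρ`, irreducibility says
that a parameter `u` is not a cube, and the second condition becomes the triple-angle equation of
the hyperbolic cotangent, solved by `u = (r^3 + 1) / (r^3 - 1)`. A polynomial argument supplies `r`
(`exists_pow_eq_one_and_add_pow_ne`, `exists_pow_eq_neg_one_and_add_pow_ne`), except for `q = 5, 7,
13`, where explicit solutions are used. -/

/-! ### Recovering the two sides of a complete bipartite subgraph -/

/-- In the image of a copy of `H`, the neighbours of `f x` are the images of those of `x`. -/
theorem SimpleGraph.Copy.neighborSet_toSubgraph {V W : Type*} {H : SimpleGraph W}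
    {G : SimpleGraph V} (f : H.Copy G) (x : W) :
    f.toSubgraph.neighborSet (f x) = f '' H.neighborSet x := by
  ext v
  simp only [SimpleGraph.Subgraph.mem_neighborSet, SimpleGraph.Copy.toSubgraph,
    SimpleGraph.Subgraph.map_adj, Relation.Map, SimpleGraph.Subgraph.top_adj, Set.mem_image,
    SimpleGraph.mem_neighborSet]
  constructor
  · rintro ⟨a, b, hab, ha, rfl⟩
    obtain rfl : a = x := f.injective ha
    exact ⟨b, hab, rfl⟩
  · rintro ⟨b, hb, rfl⟩
    exact ⟨x, b, hb, rfl, rfl⟩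

/-- The vertices of degree `n` in a copy of `K_{m,n}` with `m ≠ n` form the left side. -/
theorem SimpleGraph.Copy.setOf_ncard_neighborSet_eq {V : Type*} {G : SimpleGraph V} {m n : ℕ}
    (hmn : m ≠ n) (f : (_root_.completeBipartiteGraph (Fin m) (Fin n)).Copy G) :
    {v | v ∈ f.toSubgraph.verts ∧ (f.toSubgraph.neighborSet v).ncard = n} =
      Set.range (fun i => f (Sum.inl i)) := by
  have hl (i : Fin m) : (f.toSubgraph.neighborSet (f (Sum.inl i))).ncard = n := by
    rw [f.neighborSet_toSubgraph, Set.ncard_image_of_injective _ (show Function.Injective f from f.injective)]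
    have : (_root_.completeBipartiteGraph (Fin m) (Fin n)).neighborSet (Sum.inl i) =
        Set.range Sum.inr := by
      ext (x | x) <;> simp [_root_.completeBipartiteGraph]
    rw [this, ← Set.image_univ, Set.ncard_image_of_injective _ Sum.inr_injective, Set.ncard_univ,
      Nat.card_eq_fintype_card, Fintype.card_fin]
  have hr (i : Fin n) : (f.toSubgraph.neighborSet (f (Sum.inr i))).ncard = m := by
    rw [f.neighborSet_toSubgraph, Set.ncard_image_of_injective _ (show Function.Injective f from f.injective)]
    have : (_root_.completeBipartiteGraph (Fin m) (Fin n)).neighborSet (Sum.inr i) =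
        Set.range Sum.inl := by
      ext (x | x) <;> simp [_root_.completeBipartiteGraph]
    rw [this, ← Set.image_univ, Set.ncard_image_of_injective _ Sum.inl_injective, Set.ncard_univ,
      Nat.card_eq_fintype_card, Fintype.card_fin]
  ext v
  constructor
  · rintro ⟨hv, h⟩
    obtain ⟨x, -, rfl⟩ : ∃ x, x ∈ (⊤ : SimpleGraph.Subgraph _).verts ∧ f.toHom x = v := hv
    rcases x with x | x
    · exact ⟨x, rfl⟩
    · exact absurd ((hr x).symm.trans h) hmn
  · rintro ⟨i, rfl⟩
    exact ⟨⟨Sum.inl i, trivial, rfl⟩, hl i⟩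

theorem SimpleGraph.Copy.range_inr_eq {V : Type*} {G : SimpleGraph V} {m n : ℕ}
    (f : (_root_.completeBipartiteGraph (Fin m) (Fin n)).Copy G) :
    Set.range (fun j => f (Sum.inr j)) =
      f.toSubgraph.verts \ Set.range (fun i => f (Sum.inl i)) := by
  ext v
  constructor
  · rintro ⟨j, rfl⟩
    exact ⟨⟨_, trivial, rfl⟩, fun ⟨i, hi⟩ => Sum.inl_ne_inr (f.injective hi)⟩
  · rintro ⟨⟨x | x, -, rfl⟩, h⟩
    · exact absurd ⟨x, rfl⟩ h
    · exact ⟨x, rfl⟩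

/-- Two injective families with the same range have the same sums. -/
theorem sum_comp_eq_of_range_eq {ι V M : Type*} [Fintype ι] [AddCommMonoid M] {f g : ι → V}
    (hf : f.Injective) (hg : g.Injective) (h : Set.range f = Set.range g) (φ : V → M) :
    ∑ i, φ (f i) = ∑ i, φ (g i) := by
  classical
  have : Finset.univ.image f = Finset.univ.image g := by
    apply Finset.coe_injective
    simpa using h
  rw [← Finset.sum_image (f := φ) (g := f) hf.injOn, this, Finset.sum_image hg.injOn]

/-! ### The orbit of one solution -/

section Orbit

variable {K L : Type*} [Field K] [Field L] [Algebra K L]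

/-- The copy of `K_{4,6}` obtained from a family of solutions of `N (α i + β j) = a i * b j` by
the dilation with factor `c`, the translation by `T` and the scaling of the second coordinates by
`l`. -/
noncomputable def orbitCopy {α : Fin 4 → L} {β : Fin 6 → L} {a : Fin 4 → Kˣ} {b : Fin 6 → Kˣ}
    (hα : α.Injective) (hβ : β.Injective)
    (hN : ∀ i j, Algebra.norm K (α i + β j) = (a i : K) * b j)
    (c : Lˣ) (l : Kˣ) (T : L) (hT : ∀ i j, (c : L) * α i + T ≠ c * β j - T) :
    (completeBipartiteGraph (Fin 4) (Fin 6)).Copy (projectiveNormGraph K L) where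
  toHom :=
    { toFun := Sum.elim (fun i => ((c : L) * α i + T, l * a i))
        (fun j => ((c : L) * β j - T, Units.map (Algebra.norm K (S := L)) c * l⁻¹ * b j))
      map_rel' := by
        have key (i : Fin 4) (j : Fin 6) : (projectiveNormGraph K L).Adj
            ((c : L) * α i + T, l * a i)
            ((c : L) * β j - T, Units.map (Algebra.norm K (S := L)) c * l⁻¹ * b j) := by
          refine ⟨fun h => hT i j (congrArg Prod.fst h), ?_⟩
          have : (c : L) * α i + T + (c * β j - T) = c * (α i + β j) := by ring
          have hl := l.ne_zero
          simp only [this, map_mul, hN, Units.val_mul, Units.coe_map,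
            Units.val_inv_eq_inv_val]
          field_simp
        rintro (i | i) (j | j) h
        · simp [completeBipartiteGraph] at h
        · exact key i j
        · exact (key j i).symm
        · simp [completeBipartiteGraph] at h }
  injective' := by
    rintro (i | i) (j | j) h
    · have := congrArg Prod.fst h
      simp only [RelHom.coeFn_mk, Sum.elim_inl, add_left_inj, mul_eq_mul_left_iff, Units.ne_zero,
        or_false] at this
      rw [hα this]
    · exact absurd (congrArg Prod.fst h) (hT i j)
    · exact absurd (congrArg Prod.fst h).symm (hT j i)
    · have := congrArg Prod.fst h
      simp only [RelHom.coeFn_mk, Sum.elim_inr, sub_left_inj, mul_eq_mul_left_iff, Units.ne_zero,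
        or_false] at this
      rw [hβ this]

/-- Since `4 ≠ 6`, the subgraph determines its two sides as sets, hence the sum of the first
coordinates on each side; these sums determine `c` and then `T`. Any left vertex then gives `l`. -/
theorem orbitCopy_toSubgraph_injective {α : Fin 4 → L} {β : Fin 6 → L} {a : Fin 4 → Kˣ}
    {b : Fin 6 → Kˣ} (h2 : (2 : L) ≠ 0) (hα : α.Injective) (hβ : β.Injective)
    (hN : ∀ i j, Algebra.norm K (α i + β j) = (a i : K) * b j)
    (hsum : 3 * ∑ i, α i + 2 * ∑ j, β j ≠ 0)
    {c c' : Lˣ} {l l' : Kˣ} {T T' : L} (hT : ∀ i j, (c : L) * α i + T ≠ c * β j - T)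
    (hT' : ∀ i j, (c' : L) * α i + T' ≠ c' * β j - T')
    (h : (orbitCopy hα hβ hN c l T hT).toSubgraph = (orbitCopy hα hβ hN c' l' T' hT').toSubgraph) :
    c = c' ∧ l = l' ∧ T = T' := by
  set f := orbitCopy hα hβ hN c l T hT with hf
  set g := orbitCopy hα hβ hN c' l' T' hT' with hg
  have hl : Set.range (fun i => f (Sum.inl i)) = Set.range (fun i => g (Sum.inl i)) := by
    rw [← f.setOf_ncard_neighborSet_eq (by decide), h,
      g.setOf_ncard_neighborSet_eq (by decide)]
  have hr : Set.range (fun i => f (Sum.inr i)) = Set.range (fun i => g (Sum.inr i)) := by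
    rw [f.range_inr_eq, h, hl, ← g.range_inr_eq]
  have fl (i) : f (Sum.inl i) = ((c : L) * α i + T, l * a i) := rfl
  have gl (i) : g (Sum.inl i) = ((c' : L) * α i + T', l' * a i) := rfl
  have fr (i) : (f (Sum.inr i)).1 = (c : L) * β i - T := rfl
  have gr (i) : (g (Sum.inr i)).1 = (c' : L) * β i - T' := rfl
  have sl := sum_comp_eq_of_range_eq (f.injective.comp Sum.inl_injective)
    (g.injective.comp Sum.inl_injective) hl Prod.fst
  have sr := sum_comp_eq_of_range_eq (f.injective.comp Sum.inr_injective)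
    (g.injective.comp Sum.inr_injective) hr Prod.fst
  simp only [Function.comp_apply, SimpleGraph.Copy.coe_toHom, fl, gl, fr, gr,
    Finset.sum_add_distrib, Finset.sum_sub_distrib, ← Finset.mul_sum, Finset.sum_const,
    Finset.card_univ, Fintype.card_fin, nsmul_eq_mul] at sl sr
  push_cast at sl sr
  -- The side sums are `c ∑ α + 4 T` and `c ∑ β - 6 T`; the weights 3 and 2 eliminate `T`.
  have hc : (c : L) = c' := by
    apply mul_right_cancel₀ hsum
    linear_combination 3 * sl + 2 * sr
  have hcc : c = c' := Units.ext hc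
  subst hcc
  have hTT : T = T' := by
    have : (2 * 2 : L) ≠ 0 := mul_ne_zero h2 h2
    apply mul_left_cancel₀ this
    linear_combination sl
  subst hTT
  refine ⟨rfl, ?_, rfl⟩
  obtain ⟨i, hi⟩ : f (Sum.inl 0) ∈ Set.range (fun i => g (Sum.inl i)) := hl ▸ ⟨0, rfl⟩
  simp only [fl, gl, Prod.mk.injEq, add_left_inj, mul_eq_mul_left_iff, Units.ne_zero,
    or_false] at hi
  obtain rfl := hα hi.1
  exact (mul_right_cancel hi.2).symm

theorem le_copyCount_of_norm_add_eq [Fintype K] [DecidableEq K] [Fintype L]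
    {α : Fin 4 → L} {β : Fin 6 → L} {a : Fin 4 → Kˣ}
    {b : Fin 6 → Kˣ} (h2 : (2 : L) ≠ 0) (hα : α.Injective) (hβ : β.Injective)
    (hN : ∀ i j, Algebra.norm K (α i + β j) = (a i : K) * b j)
    (hsum : 3 * ∑ i, α i + 2 * ∑ j, β j ≠ 0) :
    ((Fintype.card L : ℤ) - 1) * ((Fintype.card K : ℤ) - 1) * ((Fintype.card L : ℤ) - 24) ≤
      ((projectiveNormGraph K L).copyCount (completeBipartiteGraph (Fin 4) (Fin 6)) : ℤ) := by
  classical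
  -- The translations keeping the two sides disjoint: a pair `(i, j)` excludes only `T = c (β j - α
  -- i) / 2`.
  let good (c : Lˣ) : Finset L := {T | ∀ i j, (c : L) * α i + T ≠ c * β j - T}
  have hgood (c : Lˣ) : Fintype.card L - 24 ≤ (good c).card := by
    have hsub : (good c)ᶜ ⊆ (Finset.univ : Finset (Fin 4 × Fin 6)).image
        (fun x => (c : L) * (β x.2 - α x.1) / 2) := by
      intro T hT
      simp only [good, Finset.mem_compl, Finset.mem_filter, Finset.mem_univ, true_and,
        not_forall, not_not] at hT
      obtain ⟨i, j, h⟩ := hT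
      refine Finset.mem_image.2 ⟨(i, j), Finset.mem_univ _, ?_⟩
      rw [div_eq_iff h2]
      linear_combination -h
    have h1 := (Finset.card_le_card hsub).trans Finset.card_image_le
    rw [Finset.card_compl] at h1
    simp only [Finset.card_univ, Fintype.card_prod, Fintype.card_fin] at h1
    omega
  let P : Finset ((_ : Lˣ × Kˣ) × L) := Finset.univ.sigma fun x => good x.1
  have hP : (Fintype.card L - 1) * (Fintype.card K - 1) * (Fintype.card L - 24) ≤ P.card := by
    rw [Finset.card_sigma]
    refine le_trans (le_of_eq ?_) (Finset.sum_le_sum fun x _ => hgood x.1)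
    rw [Finset.sum_const, Finset.card_univ, Fintype.card_prod, Fintype.card_units,
      Fintype.card_units, smul_eq_mul]
  have hmem (x) (hx : x ∈ P) :
      ∀ i j, (x.1.1 : L) * α i + x.2 ≠ x.1.1 * β j - x.2 := by
    simpa [P, good] using hx
  have hcount : P.card ≤
      (projectiveNormGraph K L).copyCount (completeBipartiteGraph (Fin 4) (Fin 6)) := by
    rw [SimpleGraph.copyCount_eq_card_image_copyToSubgraph]
    rw [← Finset.card_attach]
    refine Finset.card_le_card_of_injOn
      (fun x => (orbitCopy hα hβ hN x.1.1.1 x.1.1.2 x.1.2 (hmem x.1 x.2)).toSubgraph)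
      (fun x _ => Finset.mem_coe.2 (Finset.mem_image_of_mem _ (Finset.mem_univ _))) ?_
    rintro ⟨⟨⟨c, l⟩, T⟩, hx⟩ - ⟨⟨⟨c', l'⟩, T'⟩, hx'⟩ - h
    obtain ⟨rfl, rfl, rfl⟩ := orbitCopy_toSubgraph_injective h2 hα hβ hN hsum _ _ h
    rfl
  have hL : 1 ≤ Fintype.card L := Fintype.card_pos
  have hK : 1 ≤ Fintype.card K := Fintype.card_pos
  have h0 : (0 : ℤ) ≤ ((Fintype.card L : ℤ) - 1) * ((Fintype.card K : ℤ) - 1) :=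
    mul_nonneg (by omega) (by omega)
  calc ((Fintype.card L : ℤ) - 1) * ((Fintype.card K : ℤ) - 1) * ((Fintype.card L : ℤ) - 24)
      ≤ ((Fintype.card L : ℤ) - 1) * ((Fintype.card K : ℤ) - 1) *
          ((Fintype.card L - 24 : ℕ) : ℤ) := mul_le_mul_of_nonneg_left (by omega) h0
    _ = (((Fintype.card L - 1) * (Fintype.card K - 1) * (Fintype.card L - 24) : ℕ) : ℤ) := by
        push_cast [hL, hK]; ring
    _ ≤ _ := by exact_mod_cast hP.trans hcount

end Orbit

/-! ### Inversion and the fourth left vertex -/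

/-- A partial fraction with distinct simple poles is nonzero somewhere away from its poles, if the
field is large enough. -/
theorem exists_sum_div_sub_ne_zero {ι F : Type*} [Fintype ι] [Field F] [Fintype F]
    {u w : ι → F} (hu : u.Injective) {i₀ : ι} (hw : w i₀ ≠ 0)
    (hcard : 2 * Fintype.card ι ≤ Fintype.card F) :
    ∃ e, (∀ i, u i - e ≠ 0) ∧ ∑ i, w i / (u i - e) ≠ 0 := by
  classical
  -- `Q` is the numerator of the partial fraction and `R` its denominator. The product `Q * R` has
  -- degree at most `2 |ι| - 1`, so it cannot vanish on the whole field.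
  open Polynomial in
  let Q : F[X] := ∑ i, C (w i) * ∏ j ∈ Finset.univ.erase i, (C (u j) - X)
  let R : F[X] := ∏ j, (C (u j) - X)
  have hlin (x : F) : (C x - X : F[X]).natDegree ≤ 1 := by compute_degree
  have hlin0 (x : F) : (C x - X : F[X]) ≠ 0 := fun h => by
    have := congrArg (Polynomial.coeff · 1) h
    simp at this
  have hpos : 0 < Fintype.card ι := Fintype.card_pos_iff.2 ⟨i₀⟩
  have hprod (s : Finset ι) : (∏ j ∈ s, (C (u j) - X : F[X])).natDegree ≤ s.card := by
    refine (natDegree_prod_le _ _).trans ((Finset.sum_le_sum fun i _ => hlin (u i)).trans ?_)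
    simp
  have hQd : Q.natDegree ≤ Fintype.card ι - 1 := by
    refine natDegree_sum_le_of_forall_le _ _ fun i _ => ?_
    refine (natDegree_C_mul_le _ _).trans ((hprod _).trans ?_)
    rw [Finset.card_erase_of_mem (Finset.mem_univ _), Finset.card_univ]
  have hRd : R.natDegree ≤ Fintype.card ι := hprod Finset.univ
  have hQ0 : Q ≠ 0 := by
    intro h
    have h1 : Q.eval (u i₀) = 0 := by rw [h, eval_zero]
    simp only [Q, eval_finsetSum, eval_mul, eval_C, eval_prod, eval_sub, eval_X] at h1
    rw [Finset.sum_eq_single i₀] at h1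
    · rcases mul_eq_zero.1 h1 with h1 | h1
      · exact hw h1
      · obtain ⟨j, hj, h1⟩ := Finset.prod_eq_zero_iff.1 h1
        exact (Finset.mem_erase.1 hj).1 (hu (sub_eq_zero.1 h1))
    · intro i _ hi
      rw [Finset.prod_eq_zero (Finset.mem_erase.2 ⟨hi.symm, Finset.mem_univ _⟩) (sub_self _),
        mul_zero]
    · simp
  have hR0 : R ≠ 0 := Finset.prod_ne_zero_iff.2 fun i _ => hlin0 _
  have hQR : Q * R ≠ 0 := mul_ne_zero hQ0 hR0
  obtain ⟨e, he⟩ : ∃ e, (Q * R).eval e ≠ 0 := by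
    by_contra! h
    refine hQR (eq_zero_of_natDegree_lt_card_of_eval_eq_zero' _ Finset.univ (fun e _ => h e) ?_)
    rw [Finset.card_univ]
    have := natDegree_mul_le (p := Q) (q := R)
    omega
  rw [eval_mul] at he
  have hRe := right_ne_zero_of_mul he
  have hQe := left_ne_zero_of_mul he
  simp only [R, eval_prod, eval_sub, eval_C, eval_X] at hRe
  have hne : ∀ i, u i - e ≠ 0 := fun i => (Finset.prod_ne_zero_iff.1 hRe) i (Finset.mem_univ i)
  refine ⟨e, hne, fun h => hQe ?_⟩
  have : Q.eval e = (∏ j, (u j - e)) * ∑ i, w i / (u i - e) := by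
    simp only [Q, eval_finsetSum, eval_mul, eval_C, eval_prod, eval_sub, eval_X]
    rw [Finset.mul_sum]
    refine Finset.sum_congr rfl fun i _ => ?_
    rw [← Finset.mul_prod_erase _ _ (Finset.mem_univ i)]
    have := hne i
    field_simp
  rw [this, h, mul_zero]

/-- The identity `1/(v - e) - 1/(b - e) = (b - v) / ((v - e)(b - e))` splits the norm into a factor
depending on `v` and one depending on `b`. The bound 18 is twice the number 3 + 6 of poles of the
weighted sum as a function of `e`. -/
theorem le_copyCount_of_norm_sub_eq {K L : Type*} [Field K] [Field L] [Algebra K L]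
    [Fintype K] [DecidableEq K] [Fintype L] (h2 : (2 : L) ≠ 0) (h3 : (3 : L) ≠ 0)
    (hcard : 18 ≤ Fintype.card L) {v : Fin 3 → L} {b : Fin 6 → L} {κ : Fin 3 → K}
    (hv : v.Injective) (hb : b.Injective) (hκ : ∀ i, κ i ≠ 0)
    (hN : ∀ i j, Algebra.norm K (b j - v i) = κ i) :
    ((Fintype.card L : ℤ) - 1) * ((Fintype.card K : ℤ) - 1) * ((Fintype.card L : ℤ) - 24) ≤
      ((projectiveNormGraph K L).copyCount (completeBipartiteGraph (Fin 4) (Fin 6)) : ℤ) := by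
  have hbv (i j) : b j ≠ v i := fun h => hκ i (by
    have : FiniteDimensional K L := Module.Finite.of_finite
    rw [← hN i j, h, sub_self, Algebra.norm_zero])
  have hinj : (Sum.elim v b).Injective := hv.sumElim hb fun i j => (hbv i j).symm
  obtain ⟨e, he, hsum⟩ := exists_sum_div_sub_ne_zero
    (w := Sum.elim (fun _ : Fin 3 => (3 : L)) (fun _ : Fin 6 => -2)) hinj (i₀ := Sum.inl 0) h3
    (by simpa using hcard)
  have hve (i) : v i - e ≠ 0 := he (Sum.inl i)
  have hbe (j) : b j - e ≠ 0 := he (Sum.inr j)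
  have : FiniteDimensional K L := Module.Finite.of_finite
  have hinv {x : L} (hx : x ≠ 0) : Algebra.norm K x⁻¹ = (Algebra.norm K x)⁻¹ :=
    eq_inv_of_mul_eq_one_left (by rw [← map_mul, inv_mul_cancel₀ hx, map_one])
  let nv (i) : Kˣ := Units.map (Algebra.norm K (S := L)) (Units.mk0 _ (hve i))
  let nb (j) : Kˣ := Units.map (Algebra.norm K (S := L)) (Units.mk0 _ (hbe j))
  refine le_copyCount_of_norm_add_eq h2
    -- The entry 0 is the image of infinity under inversion; its equations hold for any `b j`.
    (α := Fin.cons 0 fun i => (v i - e)⁻¹) (β := fun j => -(b j - e)⁻¹)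
    (a := Fin.cons (Units.map (Algebra.norm K (S := L)) (-1)) fun i => Units.mk0 _ (hκ i) * (nv i)⁻¹)
    (b := fun j => (nb j)⁻¹) ?_ ?_ ?_ ?_
  · refine Fin.cons_injective_iff.2 ⟨?_, ?_⟩
    · rintro ⟨i, hi⟩
      exact inv_ne_zero (hve i) hi
    · intro i j h
      exact hv (sub_left_injective (inv_injective h))
  · intro i j h
    exact hb (sub_left_injective (inv_injective (neg_injective h)))
  · intro i j
    refine Fin.cases ?_ (fun i => ?_) i
    · simp only [Fin.cons_zero, zero_add, nb, Units.coe_map, Units.val_inv_eq_inv_val,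
        Units.val_neg, Units.val_one, Units.val_mk0]
      rw [← hinv (hbe j), ← map_mul]
      congr 1
      ring
    · have h : (v i - e)⁻¹ + -(b j - e)⁻¹ = (b j - v i) * (v i - e)⁻¹ * (b j - e)⁻¹ := by
        have h1 := hve i
        have h2 := hbe j
        field_simp
        ring
      simp only [Fin.cons_succ, h, map_mul, hN, hinv (hve i), hinv (hbe j), nb, nv, Units.val_mul,
        Units.coe_map, Units.val_inv_eq_inv_val, Units.val_mk0]
  · convert hsum using 1
    simp only [Fin.sum_univ_succ (n := 3), Fin.cons_zero, Fin.cons_succ, zero_add,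
      Fintype.sum_sum_type, Sum.elim_inl, Sum.elim_inr, Finset.mul_sum, div_eq_mul_inv,
      neg_mul, mul_neg]

/-! ### The norm form of a cubic extension -/

/-- The norm of `x + y c + z c ^ 2` over `K`, where `c ^ 3 = e₁ c ^ 2 - e₂ c + e₃`. -/
def cubicNormForm {R : Type*} [CommRing R] (e₁ e₂ e₃ x y z : R) : R :=
  x ^ 3 + e₃ * y ^ 3 + e₃ ^ 2 * z ^ 3 + e₁ * x ^ 2 * y + (e₁ ^ 2 - 2 * e₂) * x ^ 2 * z +
    e₂ * x * y ^ 2 + (e₂ ^ 2 - 2 * e₁ * e₃) * x * z ^ 2 + e₁ * e₃ * y ^ 2 * z +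
    e₂ * e₃ * y * z ^ 2 + (e₁ * e₂ - 3 * e₃) * x * y * z

section CubicExtension

variable {K L : Type*} [Field K] [Field L] [Algebra K L]

open Polynomial in
theorem irreducible_cubic {e₁ e₂ e₃ : K} (h : ∀ x : K, x ^ 3 - e₁ * x ^ 2 + e₂ * x - e₃ ≠ 0) :
    (X ^ 3 - C e₁ * X ^ 2 + C e₂ * X - C e₃ : K[X]).natDegree = 3 ∧
      Irreducible (X ^ 3 - C e₁ * X ^ 2 + C e₂ * X - C e₃ : K[X]) := by
  have hd : (X ^ 3 - C e₁ * X ^ 2 + C e₂ * X - C e₃ : K[X]).natDegree = 3 := by compute_degree!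
  refine ⟨hd, ?_⟩
  rw [irreducible_iff_roots_eq_zero_of_degree_le_three (by omega) (by omega)]
  refine Multiset.eq_zero_of_forall_notMem fun x hx => h x ?_
  simpa [IsRoot] using (mem_roots'.1 hx).2

open Polynomial in
/-- A cubic polynomial without roots in a finite field `K` has a root in every cubic extension. -/
theorem exists_root_of_forall_ne_zero [Finite L] (hL : Module.finrank K L = 3) {e₁ e₂ e₃ : K}
    (h : ∀ x : K, x ^ 3 - e₁ * x ^ 2 + e₂ * x - e₃ ≠ 0) :
    ∃ c : L, c ^ 3 = algebraMap K L e₁ * c ^ 2 - algebraMap K L e₂ * c + algebraMap K L e₃ := by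
  let f : K[X] := X ^ 3 - C e₁ * X ^ 2 + C e₂ * X - C e₃
  obtain ⟨hd, hf⟩ : f.natDegree = 3 ∧ Irreducible f := irreducible_cubic h
  have : Fact (Irreducible f) := ⟨hf⟩
  have hfin : Module.finrank K (AdjoinRoot f) = 3 := by
    rw [(AdjoinRoot.powerBasis hf.ne_zero).finrank, AdjoinRoot.powerBasis_dim, hd]
  obtain ⟨φ⟩ := FiniteField.nonempty_algHom_of_finrank_dvd (F := K) (K := AdjoinRoot f) (L := L)
    (by rw [hfin, hL])
  refine ⟨φ (AdjoinRoot.root f), ?_⟩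
  have h0 : aeval (φ (AdjoinRoot.root f)) f = 0 := by
    rw [aeval_algHom_apply, AdjoinRoot.aeval_eq, AdjoinRoot.mk_self, map_zero]
  simp only [f, map_sub, map_add, map_mul, map_pow, aeval_X, aeval_C] at h0
  linear_combination h0

variable {e₁ e₂ e₃ : K} {c : L}

open Polynomial in
/-- A root of a cubic without roots in `K` satisfies no quadratic equation over `K`. -/
theorem eq_zero_of_quadratic_eq_zero
    (h : ∀ x : K, x ^ 3 - e₁ * x ^ 2 + e₂ * x - e₃ ≠ 0)
    (hc : c ^ 3 = algebraMap K L e₁ * c ^ 2 - algebraMap K L e₂ * c + algebraMap K L e₃)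
    {x y z : K} (h0 : algebraMap K L x + algebraMap K L y * c + algebraMap K L z * c ^ 2 = 0) :
    x = 0 ∧ y = 0 ∧ z = 0 := by
  let f : K[X] := X ^ 3 - C e₁ * X ^ 2 + C e₂ * X - C e₃
  obtain ⟨hd, hf⟩ : f.natDegree = 3 ∧ Irreducible f := irreducible_cubic h
  have hfc : aeval c f = 0 := by
    simp only [f, map_sub, map_add, map_mul, map_pow, aeval_X, aeval_C]
    linear_combination hc
  let g : K[X] := C x + C y * X + C z * X ^ 2
  have hgc : aeval c g = 0 := by
    simpa [g] using h0
  have hg : g.natDegree ≤ 2 := by simp only [g]; compute_degree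
  have hg0 : g = 0 := by
    by_contra hne
    have := natDegree_le_of_dvd ((hf.dvd_iff_aeval_eq_zero hfc).1 hgc) hne
    omega
  refine ⟨?_, ?_, ?_⟩
  · simpa [g, coeff_X, coeff_one, coeff_C] using congrArg (coeff · 0) hg0
  · simpa [g, coeff_X, coeff_one, coeff_C] using congrArg (coeff · 1) hg0
  · simpa [g, coeff_X, coeff_one, coeff_C] using congrArg (coeff · 2) hg0

theorem norm_eq_cubicNormForm (hL : Module.finrank K L = 3)
    (h : ∀ x : K, x ^ 3 - e₁ * x ^ 2 + e₂ * x - e₃ ≠ 0)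
    (hc : c ^ 3 = algebraMap K L e₁ * c ^ 2 - algebraMap K L e₂ * c + algebraMap K L e₃)
    (x y z : K) :
    Algebra.norm K (algebraMap K L x + algebraMap K L y * c + algebraMap K L z * c ^ 2) =
      cubicNormForm e₁ e₂ e₃ x y z := by
  have hli : LinearIndependent K ![1, c, c ^ 2] := by
    rw [Fintype.linearIndependent_iff]
    intro g hg
    simp only [Fin.sum_univ_three, Matrix.cons_val_zero, Matrix.cons_val_one, Matrix.cons_val_two,
      Algebra.smul_def, mul_one] at hg
    obtain ⟨h0, h1, h2⟩ := eq_zero_of_quadratic_eq_zero h hc hg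
    intro i
    fin_cases i
    exacts [h0, h1, h2]
  let b := basisOfLinearIndependentOfCardEqFinrank hli (by simp [hL])
  have hb : ⇑b = ![1, c, c ^ 2] := coe_basisOfLinearIndependentOfCardEqFinrank hli _
  -- Multiplication by `x + y c + z c^2` in the basis `1, c, c^2`, reduced by the cubic relation.
  let M : Matrix (Fin 3) (Fin 3) K :=
    !![x, z * e₃, (y + z * e₁) * e₃;
       y, x - z * e₂, z * e₃ - (y + z * e₁) * e₂;
       z, y + z * e₁, x - z * e₂ + (y + z * e₁) * e₁]
  have hM : Matrix.toLin b b M = Algebra.lmul K L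
      (algebraMap K L x + algebraMap K L y * c + algebraMap K L z * c ^ 2) := by
    refine b.ext fun i => ?_
    rw [Matrix.toLin_self, hb]
    fin_cases i <;>
      simp [M, Fin.sum_univ_three, Algebra.smul_def]
    · linear_combination -algebraMap K L z * hc
    · linear_combination (-algebraMap K L y - algebraMap K L z * c
        - algebraMap K L z * algebraMap K L e₁) * hc
  rw [Algebra.norm_apply, ← hM, LinearMap.det_toLin, Matrix.det_fin_three]
  simp [M, cubicNormForm]
  ring

end CubicExtension

/-! ### Six points from a simplest cubic -/

section SimplestCubic

variable {K L : Type*} [Field K] [Field L] [Algebra K L] {a s t T : K} {c : L}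

/-- The conjugate `1 / (1 - c)` of a root `c` of `X ^ 3 - a X ^ 2 + (a - 3) X + 1` is a root. -/
theorem simplestCubic_conj
    (hc : c ^ 3 = algebraMap K L a * c ^ 2 - algebraMap K L (a - 3) * c + algebraMap K L (-1)) :
    (2 + (algebraMap K L a - 1) * c - c ^ 2) ^ 3 =
      algebraMap K L a * (2 + (algebraMap K L a - 1) * c - c ^ 2) ^ 2 -
        algebraMap K L (a - 3) * (2 + (algebraMap K L a - 1) * c - c ^ 2) +
        algebraMap K L (-1) := by
  simp only [map_sub, map_neg, map_one, map_ofNat] at hc ⊢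
  generalize algebraMap K L a = A at *
  grind

/-- The value of the involution `x ↦ (-t x + s + t) / (s x + t)` at a root `c` of
`X ^ 3 - a X ^ 2 + (a - 3) X + 1` has the same norm distance to all conjugates of `c`. -/
theorem norm_involution_sub (hL : Module.finrank K L = 3)
    (h : ∀ x : K, x ^ 3 - a * x ^ 2 + (a - 3) * x - (-1) ≠ 0)
    (hn : cubicNormForm a (a - 3) (-1) t s 0 ≠ 0)
    (hT : T * cubicNormForm a (a - 3) (-1) t s 0 =
      -cubicNormForm a (a - 3) (-1) (-(s + t)) (2 * t) s)
    (hc : c ^ 3 = algebraMap K L a * c ^ 2 - algebraMap K L (a - 3) * c + algebraMap K L (-1)) :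
    algebraMap K L s * c + algebraMap K L t ≠ 0 ∧
    ∀ w ∈ ({c, 2 + (algebraMap K L a - 1) * c - c ^ 2,
        c ^ 2 - algebraMap K L a * c + algebraMap K L a - 2} : Set L),
      Algebra.norm K ((-algebraMap K L t * c + algebraMap K L s + algebraMap K L t) /
        (algebraMap K L s * c + algebraMap K L t) - w) = T := by
  have hfin : FiniteDimensional K L := Module.finite_of_finrank_pos (by omega)
  have hden := norm_eq_cubicNormForm hL h hc t s 0
  have hd0 : algebraMap K L s * c + algebraMap K L t ≠ 0 := by
    intro h0
    apply hn
    rw [← hden, map_zero, zero_mul, add_zero, add_comm, h0, Algebra.norm_zero]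
  have key (w : L) (x y z : K)
      (hw : algebraMap K L x + algebraMap K L y * c + algebraMap K L z * c ^ 2 =
        (-algebraMap K L t * c + algebraMap K L s + algebraMap K L t) -
        w * (algebraMap K L s * c + algebraMap K L t))
      (hx : cubicNormForm a (a - 3) (-1) x y z =
        -cubicNormForm a (a - 3) (-1) (-(s + t)) (2 * t) s) :
      Algebra.norm K ((-algebraMap K L t * c + algebraMap K L s + algebraMap K L t) /
        (algebraMap K L s * c + algebraMap K L t) - w) = T := by
    apply mul_right_cancel₀ hn
    rw [hT, ← hx, ← norm_eq_cubicNormForm hL h hc x y z, ← hden, ← map_mul, hw]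
    congr 1
    simp only [map_zero, zero_mul, add_zero]
    rw [add_comm (algebraMap K L t), sub_mul, div_mul_cancel₀ _ hd0]
  refine ⟨hd0, ?_⟩
  simp only [map_sub, map_neg, map_one, map_ofNat] at hc
  -- In each case the arguments are the coordinates in `1, c, c^2` of numerator minus `w` times
  -- denominator. The three norms agree because, up to factors whose product is the same for each
  -- `w`, they are the products of `m c - w'` over all conjugates `w'` of `c`.
  rintro w (rfl | rfl | rfl)
  · refine key w (s + t) (-2 * t) (-s) ?_ ?_
    · simp only [map_add, map_mul, map_neg, map_ofNat]
      ring
    · simp only [cubicNormForm]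
      ring
  · refine key _ (-t) (-((s + t) * (a - 1) + t)) (s + t) ?_ ?_
    · simp only [map_add, map_mul, map_neg, map_sub, map_one]
      linear_combination -algebraMap K L s * hc
    · simp only [cubicNormForm]
      ring
  · refine key _ (2 * s + t - t * (a - 2)) (-(s + t) + t * a) (-t) ?_ ?_
    · simp only [map_add, map_mul, map_neg, map_sub, map_ofNat]
      linear_combination algebraMap K L s * hc
    · simp only [cubicNormForm]
      ring

/-- The six right points are the `m (v k)` and the `x i`. As `-(s^2 + s t + t^2)` is the determinant
of `m`, the map is injective on the roots, and it cannot send an irrational `v k` to a point of `K`.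
-/
theorem le_copyCount_of_simplestCubic [Fintype K] [DecidableEq K] [Fintype L]
    (h2 : (2 : K) ≠ 0) (h3 : (3 : K) ≠ 0) (hcard : 18 ≤ Fintype.card L)
    (hL : Module.finrank K L = 3)
    (h : ∀ x : K, x ^ 3 - a * x ^ 2 + (a - 3) * x + 1 ≠ 0)
    (hst : s ^ 2 + s * t + t ^ 2 ≠ 0) (hn : cubicNormForm a (a - 3) (-1) t s 0 ≠ 0)
    (hT0 : T ≠ 0)
    (hT : T * cubicNormForm a (a - 3) (-1) t s 0 =
      -cubicNormForm a (a - 3) (-1) (-(s + t)) (2 * t) s)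
    {x : Fin 3 → K} (hx : x.Injective)
    (hxT : ∀ i, x i ^ 3 - a * x i ^ 2 + (a - 3) * x i + 1 = T) :
    ((Fintype.card L : ℤ) - 1) * ((Fintype.card K : ℤ) - 1) * ((Fintype.card L : ℤ) - 24) ≤
      ((projectiveNormGraph K L).copyCount (completeBipartiteGraph (Fin 4) (Fin 6)) : ℤ) := by
  have h' : ∀ x : K, x ^ 3 - a * x ^ 2 + (a - 3) * x - (-1) ≠ 0 := by
    simpa only [sub_neg_eq_add] using h
  obtain ⟨c, hc⟩ := exists_root_of_forall_ne_zero hL h'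
  set A := algebraMap K L a with hA
  let m (u : L) : L := (-algebraMap K L t * u + algebraMap K L s + algebraMap K L t) /
        (algebraMap K L s * u + algebraMap K L t)
  let v : Fin 3 → L := ![c, 2 + (A - 1) * c - c ^ 2, c ^ 2 - A * c + A - 2]
  have hc1 : v 1 ^ 3 = A * v 1 ^ 2 - algebraMap K L (a - 3) * v 1 + algebraMap K L (-1) :=
    simplestCubic_conj hc
  have e2 : v 2 = 2 + (A - 1) * v 1 - v 1 ^ 2 := by
    simp only [v, Matrix.cons_val, map_sub, map_neg, map_one, map_ofNat] at hc ⊢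
    rw [← hA] at hc
    grind
  have hc2 : v 2 ^ 3 = A * v 2 ^ 2 - algebraMap K L (a - 3) * v 2 + algebraMap K L (-1) := by
    rw [e2]
    exact simplestCubic_conj hc1
  have e0 : v 0 = v 1 ^ 2 - A * v 1 + A - 2 := by
    simp only [v, Matrix.cons_val, map_sub, map_neg, map_one, map_ofNat] at hc ⊢
    rw [← hA] at hc
    grind
  have e0' : v 0 = 2 + (A - 1) * v 2 - v 2 ^ 2 := by
    simp only [v, Matrix.cons_val, map_sub, map_neg, map_one, map_ofNat] at hc ⊢
    rw [← hA] at hc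
    grind
  have e1' : v 1 = v 2 ^ 2 - A * v 2 + A - 2 := by
    simp only [v, Matrix.cons_val, map_sub, map_neg, map_one, map_ofNat] at hc ⊢
    rw [← hA] at hc
    grind
  have hroot (k) : v k ^ 3 = A * v k ^ 2 - algebraMap K L (a - 3) * v k + algebraMap K L (-1) := by
    fin_cases k
    exacts [hc, hc1, hc2]
  have hM (k i) : Algebra.norm K (m (v k) - v i) = T := by
    refine (norm_involution_sub hL h' hn hT (hroot k)).2 (v i) ?_
    rw [← hA]
    fin_cases k <;> fin_cases i <;>
      simp only [Fin.zero_eta, Fin.mk_one, Fin.reduceFinMk, Set.mem_insert_iff,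
        Set.mem_singleton_iff, true_or]
    · exact Or.inr (Or.inl rfl)
    · exact Or.inr (Or.inr rfl)
    · exact Or.inr (Or.inr e0)
    · exact Or.inr (Or.inl e2)
    · exact Or.inr (Or.inl e0')
    · exact Or.inr (Or.inr e1')
  have hden (k) := (norm_involution_sub hL h' hn hT (hroot k)).1
  have hxN (i k) : Algebra.norm K (algebraMap K L (x i) - v k) = T := by
    have := norm_eq_cubicNormForm hL h' (hroot k) (x i) (-1) 0
    simp only [map_neg, map_one, map_zero, zero_mul, add_zero, neg_mul, one_mul,
      ← sub_eq_add_neg] at this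
    rw [this, ← hxT i, cubicNormForm]
    ring
  have hvinj : v.Injective := by
    have q {x y z : K} := eq_zero_of_quadratic_eq_zero h' hc (x := x) (y := y) (z := z)
    have h01 : v 0 ≠ v 1 := fun e => by
      have := (q (x := -2) (y := 2 - a) (z := 1) (by
        simp only [v, Matrix.cons_val, map_sub, map_neg, map_one, map_ofNat] at e ⊢
        linear_combination e)).2.2
      exact one_ne_zero this
    have h02 : v 0 ≠ v 2 := fun e => by
      have := (q (x := 2 - a) (y := 1 + a) (z := -1) (by
        simp only [v, Matrix.cons_val, map_sub, map_neg, map_one, map_ofNat, map_add] at e ⊢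
        linear_combination e)).2.2
      exact one_ne_zero (neg_eq_zero.1 this)
    have h12 : v 1 ≠ v 2 := fun e => by
      have := (q (x := 4 - a) (y := 2 * a - 1) (z := -2) (by
        simp only [v, Matrix.cons_val, map_sub, map_neg, map_one, map_ofNat, map_mul] at e ⊢
        linear_combination e)).2.2
      exact h2 (neg_eq_zero.1 this)
    intro i j hij
    fin_cases i <;> fin_cases j <;> first | rfl | skip
    exacts [absurd hij h01, absurd hij h02, absurd hij.symm h01, absurd hij h12,
      absurd hij.symm h02, absurd hij.symm h12]
  have hminj : (fun k => m (v k)).Injective := by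
    intro i j hij
    apply hvinj
    have hi := hden i
    have hj := hden j
    simp only [m] at hij
    rw [div_eq_div_iff hi hj] at hij
    have hdet : algebraMap K L (s ^ 2 + s * t + t ^ 2) ≠ 0 :=
      (map_ne_zero (algebraMap K L)).2 hst
    apply mul_left_cancel₀ hdet
    simp only [map_add, map_mul, map_pow]
    linear_combination -hij
  have hmx (k i) : m (v k) ≠ algebraMap K L (x i) := by
    intro e
    simp only [m] at e
    rw [div_eq_iff (hden k)] at e
    obtain ⟨q0, q1, -⟩ := eq_zero_of_quadratic_eq_zero h' (hroot k) (x := s + t - x i * t)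
      (y := -t - x i * s) (z := 0) (by
        simp only [map_add, map_sub, map_neg, map_mul, map_zero]
        linear_combination e)
    apply hst
    linear_combination s * q0 - t * q1
  have e23 {n : ℕ} (hn : (n : K) ≠ 0) : (n : L) ≠ 0 := by
    rw [← map_natCast (algebraMap K L)]
    exact (map_ne_zero (algebraMap K L)).2 hn
  refine le_copyCount_of_norm_sub_eq (by simpa using e23 (n := 2) (by simpa using h2))
    (by simpa using e23 (n := 3) (by simpa using h3)) hcard (v := v)
    (b := Fin.append (fun k => m (v k)) fun i => algebraMap K L (x i)) (κ := fun _ => T) hvinj ?_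
    (fun _ => hT0) ?_
  · exact Fin.append_injective_iff.2 ⟨hminj, (algebraMap K L).injective.comp hx, hmx⟩
  · intro i j
    refine Fin.addCases (m := 3) (n := 3) (fun k => ?_) (fun k => ?_) j
    · rw [Fin.append_left]
      exact hM k i
    · rw [Fin.append_right]
      exact hxN k i

end SimplestCubic

/-! ### Finding a cube `s` with `(s + 1) / (s - 1)` not a cube -/

section CubicResidues

variable {F : Type*} [Field F]

open Polynomial in
theorem exists_finset_pow_eq [IsAlgClosed F] {n : ℕ} {ε : F} (hn : (n : F) ≠ 0) (hε : ε ≠ 0) :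
    ∃ S : Finset F, S.card = n ∧ ∀ x ∈ S, x ^ n = ε := by
  classical
  have hsep : (X ^ n - C ε).Separable := separable_X_pow_sub_C ε hn hε
  refine ⟨(X ^ n - C ε).roots.toFinset, ?_, fun x hx => ?_⟩
  · rw [Multiset.toFinset_card_of_nodup (nodup_roots hsep),
      ← (IsAlgClosed.splits _).natDegree_eq_card_roots, natDegree_X_pow_sub_C]
  · rw [Multiset.mem_toFinset, mem_roots'] at hx
    simpa [IsRoot, sub_eq_zero] using hx.2

theorem neg_one_pow_sub_of_even {R : Type*} [Ring R] {n k : ℕ} (hn : Even n) (hk : k ≤ n) :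
    (-1 : R) ^ (n - k) = (-1) ^ k := by
  rcases Nat.even_or_odd k with h | h
  · rw [h.neg_one_pow, ((Nat.even_sub hk).2 (iff_of_true hn h)).neg_one_pow]
  · rw [h.neg_one_pow, ((Nat.odd_sub hk).2 (iff_of_false (Nat.not_odd_iff_even.2 hn)
      (Nat.not_even_iff_odd.2 h))).neg_one_pow]

open Polynomial in
theorem coeff_X_sub_one_pow {R : Type*} [Ring R] {n k : ℕ} (hn : Even n) (hk : k ≤ n) :
    ((X - C 1 : R[X]) ^ n).coeff k = (-1) ^ k * (n.choose k : R) := by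
  rw [sub_eq_add_neg, ← C_neg, coeff_X_add_C_pow, neg_one_pow_sub_of_even hn hk]

-- Otherwise `(X + 1)^n + (X - 1)^n - 2 (X^n + 1)`, of degree below `n`, vanishes at all `n` roots
-- of `X^n = -1`. Its `X^2` coefficient then gives `n (n - 1) = 0`, against `3 n = 1`.
open Polynomial in
theorem exists_pow_eq_neg_one_and_add_pow_ne [IsAlgClosed F] (h2 : (2 : F) ≠ 0) {n : ℕ}
    (hn : Even n) (hn4 : 4 ≤ n) (h3n : 3 * (n : F) = 1) :
    ∃ s : F, s ^ n = -1 ∧ (s + 1) ^ n ≠ -(s - 1) ^ n := by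
  have hn0 : (n : F) ≠ 0 := fun h => by simp [h] at h3n
  obtain ⟨S, hS, hSn⟩ := exists_finset_pow_eq hn0 (neg_ne_zero.2 (one_ne_zero (α := F)))
  by_contra! hcon
  let P : F[X] := (X + C 1) ^ n + (X - C 1) ^ n - C 2 * (X ^ n + 1)
  have hcoeff (k : ℕ) (hk : k ≤ n) :
      P.coeff k = (n.choose k : F) * (1 + (-1) ^ k) -
        2 * ((if k = n then 1 else 0) + if k = 0 then 1 else 0) := by
    simp only [P, coeff_sub, coeff_add, coeff_X_add_C_pow, coeff_X_sub_one_pow hn hk, coeff_C_mul,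
      coeff_X_pow, coeff_one, one_pow]
    ring
  have hdeg : P.natDegree ≤ n := by simp only [P]; compute_degree
  have hP : P = 0 := by
    refine eq_zero_of_degree_lt_of_eval_finset_eq_zero S ?_ fun s hs => ?_
    · rw [hS, degree_lt_iff_coeff_zero]
      intro m hm
      rcases hm.eq_or_lt with rfl | hm
      · rw [hcoeff _ le_rfl, if_pos rfl, if_neg (by omega), hn.neg_one_pow]
        simp
        norm_num
      · exact coeff_eq_zero_of_natDegree_lt (hdeg.trans_lt hm)
    · simp [P, hcon s (hSn s hs), hSn s hs]
  have h := hcoeff 2 (by omega)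
  rw [hP, coeff_zero, if_neg (by omega), if_neg (by omega)] at h
  have hc : (n : F) * (n - 1) = 2 * (n.choose 2 : F) := by
    have : NeZero (2 : F) := ⟨h2⟩
    rw [Nat.cast_choose_two]
    field_simp
  have h0 : (n : F) * (n - 1) = 0 := by
    rw [hc]
    linear_combination -h
  rcases mul_eq_zero.1 h0 with h0 | h0
  · exact hn0 h0
  · apply h2
    linear_combination h3n - 3 * h0

-- Otherwise `(X + 1)^n - (X - 1)^n` vanishes at every `n`-th root of unity except possibly `±1`.
-- This forces its coefficients at `X`, `X^3`, `X^5` to agree, so `n = C(n, 3) = C(n, 5)` in `F`,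
-- which is incompatible with `3 n = -1`.
open Polynomial in
theorem exists_pow_eq_one_and_add_pow_ne [IsAlgClosed F] (h2 : (2 : F) ≠ 0) (h3 : (3 : F) ≠ 0)
    {n : ℕ} (hn : Even n) (hn6 : 6 ≤ n) (h3n : 3 * (n : F) = -1) :
    ∃ s : F, s ^ n = 1 ∧ s ^ 2 ≠ 1 ∧ (s + 1) ^ n ≠ (s - 1) ^ n := by
  classical
  have hn0 : (n : F) ≠ 0 := fun h => by simp [h] at h3n
  obtain ⟨S, hS, hSn⟩ := exists_finset_pow_eq hn0 (one_ne_zero (α := F))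
  by_contra! hcon
  let A : F[X] := (X + C 1) ^ n - (X - C 1) ^ n
  have hA (k : ℕ) (hk : k ≤ n) : A.coeff k = (n.choose k : F) * (1 - (-1) ^ k) := by
    simp only [A, coeff_sub, coeff_X_add_C_pow, coeff_X_sub_one_pow hn hk, one_pow]
    ring
  have hAdeg : A.natDegree ≤ n := by simp only [A]; compute_degree
  have hAn : ∀ m, n ≤ m → A.coeff m = 0 := fun m hm => by
    rcases hm.eq_or_lt with rfl | hm
    · rw [hA _ le_rfl, hn.neg_one_pow]
      simp
    · exact coeff_eq_zero_of_natDegree_lt (hAdeg.trans_lt hm)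
  -- The factor `X^2 - 1` takes care of `±1`. The subtracted term cancels the leading term `2 n
  -- X^(n+1)` and vanishes at 0 and at the `n`-th roots of unity, so `P` has degree at most `n` and
  -- `n + 1` zeros.
  let P : F[X] := A * X ^ 2 - A - C (2 * n : F) * (X ^ (n + 1) - X)
  have hPc (k : ℕ) : P.coeff (k + 2) = A.coeff k - A.coeff (k + 2) -
      2 * n * (if k + 2 = n + 1 then 1 else 0) := by
    simp only [P, coeff_sub, coeff_mul_X_pow, coeff_C_mul, coeff_X_pow, coeff_X]
    simp
  have hP : P = 0 := by
    refine eq_zero_of_degree_lt_of_eval_finset_eq_zero (insert 0 S) ?_ fun s hs => ?_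
    · have h0S : (0 : F) ∉ S := fun h => by
        have := hSn 0 h
        rw [zero_pow (by omega)] at this
        exact zero_ne_one this
      rw [Finset.card_insert_of_notMem h0S, hS, degree_lt_iff_coeff_zero]
      intro m hm
      obtain ⟨k, rfl⟩ : ∃ k, m = k + 2 := ⟨m - 2, by omega⟩
      rw [hPc, hAn (k + 2) (by omega)]
      by_cases hk : k + 2 = n + 1
      · have hodd : Odd k := by
          obtain ⟨r, hr⟩ := hn
          exact ⟨r - 1, by omega⟩
        have hch : n.choose k = n := by
          rw [show k = n - 1 by omega, Nat.choose_symm (by omega), Nat.choose_one_right]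
        rw [if_pos hk, hA k (by omega), hodd.neg_one_pow, hch]
        ring
      · rw [if_neg hk, hAn k (by omega)]
        ring
    · rcases Finset.mem_insert.1 hs with rfl | hs
      · simp [P, A, hn.neg_one_pow]
      · have hs1 := hSn s hs
        simp only [P, A, eval_sub, eval_mul, eval_pow, eval_add, eval_X, eval_C]
        by_cases hs2 : s ^ 2 = 1
        · rw [hs2, pow_succ s n, hs1]
          ring
        · rw [hcon s hs1 hs2, pow_succ s n, hs1]
          ring
  have c3 : A.coeff 1 = A.coeff 3 := by
    have := hPc 1
    rw [hP, coeff_zero, if_neg (by omega)] at this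
    linear_combination -this
  have c5 : A.coeff 3 = A.coeff 5 := by
    have := hPc 3
    rw [hP, coeff_zero, if_neg (by omega)] at this
    linear_combination -this
  rw [hA _ (by omega), hA _ (by omega)] at c3 c5
  norm_num at c3 c5
  replace c3 : (n : F) = n.choose 3 := by
    rcases c3 with c3 | c3
    · exact c3
    · exact absurd (by linear_combination c3) h2
  replace c5 : (n.choose 3 : F) = n.choose 5 := by
    rcases c5 with c5 | c5
    · exact c5
    · exact absurd (by linear_combination c5) h2
  obtain ⟨m, rfl⟩ : ∃ m, n = m + 6 := ⟨n - 6, by omega⟩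
  have d3 : ((m + 6 : ℕ) : F) * ((m + 6 : ℕ) - 1) * ((m + 6 : ℕ) - 2) =
      6 * ((m + 6).choose 3 : F) := by
    have := Nat.descFactorial_eq_factorial_mul_choose (m + 6) 3
    simp only [Nat.descFactorial, Nat.factorial] at this
    have := congrArg (Nat.cast (R := F)) this
    rw [show m + 6 - 2 = m + 4 by omega, show m + 6 - 1 = m + 5 by omega] at this
    push_cast at this ⊢
    linear_combination this
  have d5 : ((m + 6 : ℕ) : F) * ((m + 6 : ℕ) - 1) * ((m + 6 : ℕ) - 2) * ((m + 6 : ℕ) - 3) *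
      ((m + 6 : ℕ) - 4) = 120 * ((m + 6).choose 5 : F) := by
    have := Nat.descFactorial_eq_factorial_mul_choose (m + 6) 5
    simp only [Nat.descFactorial, Nat.factorial] at this
    have := congrArg (Nat.cast (R := F)) this
    rw [show m + 6 - 2 = m + 4 by omega, show m + 6 - 1 = m + 5 by omega,
      show m + 6 - 3 = m + 3 by omega, show m + 6 - 4 = m + 2 by omega] at this
    push_cast at this ⊢
    linear_combination this
  generalize ((m + 6 : ℕ) : F) = N at *
  rw [← c5, ← c3] at d5
  rw [← c3] at d3
  have e3 : (N - 1) * (N - 2) = 6 := mul_left_cancel₀ hn0 (by linear_combination d3)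
  have e5 : (N - 1) * (N - 2) * (N - 3) * (N - 4) = 120 :=
    mul_left_cancel₀ hn0 (by linear_combination d5)
  -- Substituting `3 N = -1` in `(N - 1)(N - 2) = 6` gives `28 = 54`. In characteristic 13 the other
  -- equation, `(N - 3)(N - 4) = 20`, fails.
  have h26 : (26 : F) = 0 := by
    linear_combination -9 * e3 + (3 * N - 10) * h3n
  have h13 : (13 : F) = 0 := by
    apply mul_left_cancel₀ h2
    linear_combination h26
  have h6 : (6 : F) * ((N - 3) * (N - 4) - 20) = 0 := by
    linear_combination e5 - (N - 3) * (N - 4) * e3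
  have h1 : (3 : F) = 0 := by
    grind
  exact h3 h1

end CubicResidues

/-! ### Diagonalising the simplest cubic over a field containing `ω` -/

section SplittingParameter

variable {F : Type*} [Field F] {ω u T a x : F}

/-- This is the triple-angle formula of the hyperbolic cotangent: with `r = exp (2 θ)`, the two
fractions are `coth θ` and `coth (3 θ)`. -/
theorem tangent_cubic {r : F} (hr : r ^ 3 ≠ 1) :
    ((r + 1) / (r - 1)) ^ 3 - 3 * ((r ^ 3 + 1) / (r ^ 3 - 1)) * ((r + 1) / (r - 1)) ^ 2 +
      3 * ((r + 1) / (r - 1)) - (r ^ 3 + 1) / (r ^ 3 - 1) = 0 := by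
  have h1 : r ^ 3 - 1 ≠ 0 := sub_ne_zero.2 hr
  have h2 : r - 1 ≠ 0 := fun h => h1 (by linear_combination (r ^ 2 + r + 1) * h)
  field_simp
  ring

/-- At `u T = 1` the two middle terms of the cubic cancel, leaving `u^4 = 1`. -/
theorem one_sub_mul_ne_zero_of_cubic (hu1 : u ^ 2 ≠ 1) (hu2 : u ^ 2 ≠ -1)
    (hT : T ^ 3 - 3 * u * T ^ 2 + 3 * T - u = 0) : 1 - u * T ≠ 0 := by
  intro h
  have h1 : (u ^ 2 - 1) * (u ^ 2 + 1) = 0 := by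
    linear_combination -u ^ 3 * hT - ((u * T) ^ 2 + u * T + 1 - 3 * u ^ 2 * (u * T)) * h
  rcases mul_eq_zero.1 h1 with h1 | h1
  · exact hu1 (by linear_combination h1)
  · exact hu2 (by linear_combination h1)

/-- The fixed points of `x ↦ 1 / (1 - x)` are `-ω` and `-ω^2`; in terms of the corresponding linear
forms the cubic has only pure cubes. -/
theorem three_mul_sub_mul_simplestCubic (hω : ω ^ 2 + ω + 1 = 0) :
    3 * (ω - ω ^ 2) * (x ^ 3 - a * x ^ 2 + (a - 3) * x + 1) =
      (a + 3 * ω) * (x + ω ^ 2) ^ 3 - (a + 3 * ω ^ 2) * (x + ω) ^ 3 := by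
  grind

theorem sub_sq_sq_eq_neg_three (hω : ω ^ 2 + ω + 1 = 0) : (ω - ω ^ 2) ^ 2 = -3 := by
  linear_combination (ω ^ 2 - 3 * ω + 3) * hω

theorem sub_sq_ne_zero (h3 : (3 : F) ≠ 0) (hω : ω ^ 2 + ω + 1 = 0) : ω - ω ^ 2 ≠ 0 := fun h =>
  h3 (by linear_combination sub_sq_sq_eq_neg_three hω - (ω - ω ^ 2) * h)

theorem splitting_parameter_ne_zero (h3 : (3 : F) ≠ 0) (hω : ω ^ 2 + ω + 1 = 0)
    (hu0 : u ≠ 0) (hu1 : u ^ 2 ≠ 1) (ha : a * (1 + u ^ 2) = -3 * (ω + u ^ 2 * ω ^ 2)) :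
    2 * a - 3 ≠ 0 ∧ a ^ 2 - 3 * a + 9 ≠ 0 := by
  have hδ2 := sub_sq_sq_eq_neg_three hω
  have hδ := sub_sq_ne_zero h3 hω
  have e3 : (a + 3 * ω) * (1 + u ^ 2) = 3 * u ^ 2 * (ω - ω ^ 2) := by linear_combination ha
  have e4 : (a + 3 * ω ^ 2) * (1 + u ^ 2) = -3 * (ω - ω ^ 2) := by
    linear_combination ha
  constructor
  · intro h
    have h0 : 3 * (ω - ω ^ 2) * (u ^ 2 - 1) = 0 := by
      linear_combination -e3 - e4 + (1 + u ^ 2) * h + 3 * (1 + u ^ 2) * hω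
    exact mul_ne_zero (mul_ne_zero h3 hδ) (sub_ne_zero.2 hu1) h0
  · intro h
    have h0 : 9 * u ^ 2 * (ω - ω ^ 2) ^ 2 = 0 := by
      have hD : (a + 3 * ω) * (a + 3 * ω ^ 2) = 0 := by
        linear_combination h + (3 * a + 9 * (ω - 1)) * hω
      linear_combination -3 * (ω - ω ^ 2) * e3 + (a + 3 * ω) * (1 + u ^ 2) * e4
        - (1 + u ^ 2) ^ 2 * hD
    rw [hδ2] at h0
    have h9 : (9 : F) = 3 * 3 := by norm_num
    rw [h9] at h0
    simp [h3, hu0] at h0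

/-- The choice of `a` makes `(a + 3 ω) / (a + 3 ω^2) = -u^2`, and that of `x` makes `(x + ω) / (x +
ω^2) = u T`. After clearing denominators the claim is the cubic equation for `T`. -/
theorem splitting_parameter_identity (h3 : (3 : F) ≠ 0) (hω : ω ^ 2 + ω + 1 = 0)
    (hu1 : u ^ 2 ≠ 1) (hu2 : u ^ 2 ≠ -1)
    (hT : T ^ 3 - 3 * u * T ^ 2 + 3 * T - u = 0)
    (ha : a * (1 + u ^ 2) = -3 * (ω + u ^ 2 * ω ^ 2))
    (hx : x * (1 - u * T) = -(ω - u * T * ω ^ 2)) :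
    (2 * a - 3) * (x ^ 3 - a * x ^ 2 + (a - 3) * x + 1) = a ^ 2 - 3 * a + 9 := by
  have h1 := one_sub_mul_ne_zero_of_cubic hu1 hu2 hT
  have h2 : 1 + u ^ 2 ≠ 0 := fun h => hu2 (by linear_combination h)
  have hδ2 := sub_sq_sq_eq_neg_three hω
  have hδ := sub_sq_ne_zero h3 hω
  have e1 : (x + ω) * (1 - u * T) = -(u * T) * (ω - ω ^ 2) := by linear_combination hx
  have e2 : (x + ω ^ 2) * (1 - u * T) = -(ω - ω ^ 2) := by linear_combination hx
  have e3 : (a + 3 * ω) * (1 + u ^ 2) = 3 * u ^ 2 * (ω - ω ^ 2) := by linear_combination ha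
  have e4 : (a + 3 * ω ^ 2) * (1 + u ^ 2) = -3 * (ω - ω ^ 2) := by linear_combination ha
  have e5 : (2 * a - 3) * (1 + u ^ 2) = 3 * (ω - ω ^ 2) * (u ^ 2 - 1) := by
    linear_combination e3 + e4 - 3 * (1 + u ^ 2) * hω
  have e6 : (a ^ 2 - 3 * a + 9) * (1 + u ^ 2) ^ 2 = 27 * u ^ 2 := by
    have : a ^ 2 - 3 * a + 9 = (a + 3 * ω) * (a + 3 * ω ^ 2) := by
      linear_combination -(3 * a + 9 * (ω - 1)) * hω
    calc _ = ((a + 3 * ω) * (1 + u ^ 2)) * ((a + 3 * ω ^ 2) * (1 + u ^ 2)) := by rw [this]; ring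
      _ = -9 * u ^ 2 * (ω - ω ^ 2) ^ 2 := by rw [e3, e4]; ring
      _ = _ := by rw [hδ2]; ring
  have e7 : (x ^ 3 - a * x ^ 2 + (a - 3) * x + 1) * ((1 - u * T) ^ 3 * (1 + u ^ 2)) =
      3 * u ^ 2 * (ω - ω ^ 2) * (1 + u * T ^ 3) := by
    apply mul_left_cancel₀ (mul_ne_zero h3 hδ)
    calc _ = 3 * (ω - ω ^ 2) * (x ^ 3 - a * x ^ 2 + (a - 3) * x + 1) *
          ((1 - u * T) ^ 3 * (1 + u ^ 2)) := by ring
      _ = ((a + 3 * ω) * (1 + u ^ 2)) * ((x + ω ^ 2) * (1 - u * T)) ^ 3 -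
          ((a + 3 * ω ^ 2) * (1 + u ^ 2)) * ((x + ω) * (1 - u * T)) ^ 3 := by
        rw [three_mul_sub_mul_simplestCubic hω]; ring
      _ = -3 * u ^ 2 * (1 + u * T ^ 3) * ((ω - ω ^ 2) ^ 2) ^ 2 := by
        rw [e1, e2, e3, e4]; ring
      _ = 9 * u ^ 2 * (1 + u * T ^ 3) * (ω - ω ^ 2) ^ 2 := by rw [hδ2]; ring
      _ = _ := by ring
  apply mul_right_cancel₀ (mul_ne_zero (pow_ne_zero 3 h1) (pow_ne_zero 2 h2))
  calc _ = ((2 * a - 3) * (1 + u ^ 2)) *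
        ((x ^ 3 - a * x ^ 2 + (a - 3) * x + 1) * ((1 - u * T) ^ 3 * (1 + u ^ 2))) := by ring
    _ = 9 * u ^ 2 * (u ^ 2 - 1) * (1 + u * T ^ 3) * (ω - ω ^ 2) ^ 2 := by rw [e5, e7]; ring
    -- `(1 - u^2)(1 + u T^3) - (1 - u T)^3` is `u` times the cubic in `T`.
    _ = 27 * u ^ 2 * (1 - u * T) ^ 3 := by rw [hδ2]; linear_combination 27 * u ^ 3 * hT
    _ = ((a ^ 2 - 3 * a + 9) * (1 + u ^ 2) ^ 2) * (1 - u * T) ^ 3 := by rw [e6]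
    _ = _ := by ring

/-- A root of `X ^ 3 - a X ^ 2 + (a - 3) X + 1` yields a cube root of `u ^ 2`. -/
theorem pow_three_eq_of_simplestCubic_eq_zero (h3 : (3 : F) ≠ 0) (hω : ω ^ 2 + ω + 1 = 0)
    (hu2 : u ^ 2 ≠ -1)
    (ha : a * (1 + u ^ 2) = -3 * (ω + u ^ 2 * ω ^ 2))
    (hx : x ^ 3 - a * x ^ 2 + (a - 3) * x + 1 = 0) :
    x + ω ^ 2 ≠ 0 ∧ (-(x + ω) / (x + ω ^ 2)) ^ 3 = u ^ 2 := by
  have h2 : 1 + u ^ 2 ≠ 0 := fun h => hu2 (by linear_combination h)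
  have hδ2 := sub_sq_sq_eq_neg_three hω
  have hδ := sub_sq_ne_zero h3 hω
  have e3 : (a + 3 * ω) * (1 + u ^ 2) = 3 * u ^ 2 * (ω - ω ^ 2) := by linear_combination ha
  have e4 : (a + 3 * ω ^ 2) * (1 + u ^ 2) = -3 * (ω - ω ^ 2) := by linear_combination ha
  have key : u ^ 2 * (x + ω ^ 2) ^ 3 + (x + ω) ^ 3 = 0 := by
    apply mul_left_cancel₀ (mul_ne_zero h3 hδ)
    have := three_mul_sub_mul_simplestCubic (a := a) (x := x) hω
    rw [hx] at this
    linear_combination -(1 + u ^ 2) * this - (x + ω ^ 2) ^ 3 * e3 + (x + ω) ^ 3 * e4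
  have h0 : x + ω ^ 2 ≠ 0 := by
    intro h
    rw [h] at key
    have : x + ω = 0 := by simpa using key
    apply hδ
    linear_combination this - h
  refine ⟨h0, ?_⟩
  rw [div_pow, div_eq_iff (pow_ne_zero 3 h0)]
  linear_combination -key

/-- The map `y ↦ (y + 1) / (y - 1)` commutes with `y ↦ -1 / y`, so the twisted action passes from
`r` to `T` and from `r^3` to `u`. -/
theorem twist_add_one_div_sub_one {y : F} (hy : y ≠ 0) (h2 : y + 1 ≠ 0) :
    (-y⁻¹ + 1) / (-y⁻¹ - 1) = -((y + 1) / (y - 1))⁻¹ := by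
  have h : -y⁻¹ - 1 ≠ 0 := fun h => h2 (by
    have := congrArg (· * y) h
    simp only [sub_mul, neg_mul, inv_mul_cancel₀ hy, zero_mul] at this
    linear_combination -this)
  rw [div_eq_iff h, inv_div]
  field_simp
  ring

end SplittingParameter

/-! ### Descent of the parameter to the base field -/

section Descent

variable {K F : Type*} [Field K] [Field F] [Algebra K F]

/-- The existence statement for `a` and the points `x i`, obtained from a parameter `r` in an
extension field. In the first case of `hcase` all data are fixed by `σ`; the second case is the
twisted form, in which `σ` acts by inversion. -/
theorem exists_splitting_parameter_of_twist (σ : F →+* F)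
    (hfix : ∀ x, σ x = x → ∃ k, algebraMap K F k = x)
    (hσ : ∀ k, σ (algebraMap K F k) = algebraMap K F k) (h2 : (2 : F) ≠ 0) (h3 : (3 : F) ≠ 0)
    {ω r : F} (hω : ω ^ 2 + ω + 1 = 0) (hr0 : r ≠ 0) (hr1 : r ^ 3 ≠ 1) (hr2 : r ^ 3 ≠ -1)
    (hcase : (σ ω = ω ∧ σ r = r ∧ ∀ y, σ y = y → y ^ 3 ≠ (r ^ 3 + 1) / (r ^ 3 - 1)) ∨
      (σ ω = ω ^ 2 ∧ σ r = -r⁻¹ ∧ ∀ y, σ y = -y⁻¹ → y ^ 3 ≠ (r ^ 3 + 1) / (r ^ 3 - 1))) :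
    ∃ a : K, (∀ z, z ^ 3 - a * z ^ 2 + (a - 3) * z + 1 ≠ 0) ∧ 2 * a - 3 ≠ 0 ∧
      a ^ 2 - 3 * a + 9 ≠ 0 ∧ ∃ x : Fin 3 → K, x.Injective ∧
        ∀ i, (2 * a - 3) * (x i ^ 3 - a * x i ^ 2 + (a - 3) * x i + 1) = a ^ 2 - 3 * a + 9 := by
  have hω3 : ω ^ 3 = 1 := by linear_combination (ω - 1) * hω
  have hω0 : ω ≠ 0 := fun h => by simp [h] at hω3
  have hd1 : r ^ 3 - 1 ≠ 0 := sub_ne_zero.2 hr1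
  have hd2 : r ^ 3 + 1 ≠ 0 := fun h => hr2 (by linear_combination h)
  set u := (r ^ 3 + 1) / (r ^ 3 - 1) with hu
  have hu0 : u ≠ 0 := div_ne_zero hd2 hd1
  have hur : u * (r ^ 3 - 1) = r ^ 3 + 1 := div_mul_cancel₀ _ hd1
  have hu1 : u ^ 2 ≠ 1 := by
    intro h
    have : 2 * 2 * r ^ 3 = 0 := by
      linear_combination (r ^ 3 - 1) ^ 2 * h - (u * (r ^ 3 - 1) + (r ^ 3 + 1)) * hur
    simp [h2, hr0] at this
  have hσu : (σ ω = ω ∧ σ u = u ∧ ∀ y, σ y = y → y ^ 3 ≠ u) ∨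
      (σ ω = ω ^ 2 ∧ σ u = -u⁻¹ ∧ ∀ y, σ y = -y⁻¹ → y ^ 3 ≠ u) := by
    rcases hcase with ⟨hσω, hσr, h⟩ | ⟨hσω, hσr, h⟩
    · refine Or.inl ⟨hσω, ?_, h⟩
      simp [hu, hσr]
    · refine Or.inr ⟨hσω, ?_, h⟩
      have e : (-r⁻¹) ^ 3 = -(r ^ 3)⁻¹ := by rw [neg_pow, inv_pow]; norm_num
      simp only [hu, map_div₀, map_add, map_sub, map_pow, map_one, hσr, e]
      exact twist_add_one_div_sub_one (pow_ne_zero 3 hr0) hd2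
  -- If `u^2 = -1`, then `u = (-u)^3` is an excluded cube.
  have hu2 : u ^ 2 ≠ -1 := by
    intro h
    have h' : (-u) ^ 3 = u := by linear_combination -u * h
    rcases hσu with ⟨-, hs, hc⟩ | ⟨-, hs, hc⟩
    · exact hc (-u) (by rw [map_neg, hs]) h'
    · exact hc (-u) (by rw [map_neg, hs, inv_neg]) h'
  have hq : 1 + u ^ 2 ≠ 0 := fun h => hu2 (by linear_combination h)
  set A := -3 * (ω + u ^ 2 * ω ^ 2) / (1 + u ^ 2) with hA
  have hAu : A * (1 + u ^ 2) = -3 * (ω + u ^ 2 * ω ^ 2) := div_mul_cancel₀ _ hq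
  have hσA : σ A = A := by
    rcases hσu with ⟨hw, hs, -⟩ | ⟨hw, hs, -⟩
    · simp [hA, hw, hs, map_ofNat]
    · have h := congrArg σ hAu
      simp only [map_mul, map_add, map_one, map_pow, hs, hw, map_neg, map_ofNat] at h
      have hi : u * u⁻¹ = 1 := mul_inv_cancel₀ hu0
      apply mul_right_cancel₀ hq
      rw [hAu]
      linear_combination u ^ 2 * h - (σ A + 3 * ω ^ 4) * (u * u⁻¹ + 1) * hi - 3 * ω * hω3
  obtain ⟨a, ha⟩ := hfix A hσA
  -- Replacing `r` by `ω^k r` leaves `u` unchanged and gives the three roots of the triple-angle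
  -- equation.
  let T (k : ℕ) : F := (ω ^ k * r + 1) / (ω ^ k * r - 1)
  let X (k : ℕ) : F := -(ω - u * T k * ω ^ 2) / (1 - u * T k)
  have hk3 (k : ℕ) : (ω ^ k * r) ^ 3 = r ^ 3 := by
    rw [mul_pow, ← pow_mul, mul_comm k, pow_mul, hω3, one_pow, one_mul]
  have hT (k : ℕ) : T k ^ 3 - 3 * u * T k ^ 2 + 3 * T k - u = 0 := by
    have := tangent_cubic (r := ω ^ k * r) (by rwa [hk3])
    rwa [hk3] at this
  have hTd (k : ℕ) : 1 - u * T k ≠ 0 := one_sub_mul_ne_zero_of_cubic hu1 hu2 (hT k)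
  have hXu (k : ℕ) : X k * (1 - u * T k) = -(ω - u * T k * ω ^ 2) := div_mul_cancel₀ _ (hTd k)
  have hrd (k : ℕ) : ω ^ k * r - 1 ≠ 0 := fun h => hr1 (by
    rw [← hk3 k, sub_eq_zero.1 h, one_pow])
  have hrd' (k : ℕ) : ω ^ k * r + 1 ≠ 0 := fun h => hr2 (by
    rw [← hk3 k, eq_neg_of_add_eq_zero_left h]; norm_num)
  have hT0 (k : ℕ) : T k ≠ 0 := div_ne_zero (hrd' k) (hrd k)
  have hσX (k : ℕ) : σ (X k) = X k := by
    rcases hσu with ⟨hw, hs, -⟩ | ⟨hw, hs, -⟩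
    · have hr : σ r = r := by
        rcases hcase with ⟨-, h, -⟩ | ⟨h, -⟩
        · exact h
        · exact absurd (sub_eq_zero.2 (hw.symm.trans h)) (sub_sq_ne_zero h3 hω)
      simp [X, T, hw, hs, hr]
    · have hr : σ r = -r⁻¹ := by
        rcases hcase with ⟨h, -⟩ | ⟨-, h, -⟩
        · exact absurd (sub_eq_zero.2 (h.symm.trans hw)) (sub_sq_ne_zero h3 hω)
        · exact h
      have hkr : σ (ω ^ k * r) = -(ω ^ k * r)⁻¹ := by
        have : ω ^ 2 = ω⁻¹ := eq_inv_of_mul_eq_one_left (by rw [← hω3]; ring)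
        rw [map_mul, map_pow, hw, hr, this, mul_inv, inv_pow, mul_neg]
      have hσT : σ (T k) = -(T k)⁻¹ := by
        simp only [T, map_div₀, map_add, map_sub, map_one, hkr]
        exact twist_add_one_div_sub_one (mul_ne_zero (pow_ne_zero k hω0) hr0) (hrd' k)
      have h := congrArg σ (hXu k)
      simp only [map_mul, map_sub, map_one, map_pow, hs, hw, map_neg, hσT] at h
      have hi : u * u⁻¹ = 1 := mul_inv_cancel₀ hu0
      have hj : T k * (T k)⁻¹ = 1 := mul_inv_cancel₀ (hT0 k)
      have hij : u * T k * (u⁻¹ * (T k)⁻¹) = 1 := by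
        rw [mul_mul_mul_comm, hi, hj, one_mul]
      apply mul_right_cancel₀ (hTd k)
      rw [hXu k]
      linear_combination -(u * T k) * h + (-σ (X k) - ω ^ 4) * hij - ω * hω3
  choose x hx using fun k => hfix (X k) (hσX k)
  have hinj := (algebraMap K F).injective
  refine ⟨a, fun z hz => ?_, fun h => ?_, fun h => ?_, fun i => x i, ?_, fun i => ?_⟩
  · have hz' := congrArg (algebraMap K F) hz
    simp only [map_add, map_sub, map_mul, map_pow, map_one, map_ofNat, map_zero, ha] at hz'
    obtain ⟨hz0, hw⟩ := pow_three_eq_of_simplestCubic_eq_zero h3 hω hu2 hAu hz'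
    have hσz := hσ z
    generalize algebraMap K F z = y at *
    set w := -(y + ω) / (y + ω ^ 2) with hw'
    have hw0 : w ≠ 0 := fun h => hu0 (by simpa [h] using hw.symm)
    -- From `w^3 = u^2`, the quotient `u / w` is a cube root of `u`; `σ` acts on it as on `u`, which
    -- the hypothesis forbids.
    have hy3 : (u / w) ^ 3 = u := by
      rw [div_pow, hw]
      field_simp
    rcases hσu with ⟨hω', hs, hc⟩ | ⟨hω', hs, hc⟩
    · exact hc (u / w) (by simp [hw', hσz, hs, hω']) hy3
    · refine hc (u / w) ?_ hy3
      have hσw : σ w = w⁻¹ := by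
        have h4 : (ω ^ 2) ^ 2 = ω := by linear_combination ω * hω3
        simp only [hw', map_div₀, map_neg, map_add, map_pow, hω', hσz, h4]
        rw [inv_div, neg_div, div_neg]
      rw [map_div₀, hs, hσw, div_inv_eq_mul, neg_mul, neg_inj, mul_comm, ← div_eq_mul_inv]
      exact (inv_div u w).symm
  · have := congrArg (algebraMap K F) h
    simp only [map_sub, map_mul, map_ofNat, map_zero, ha] at this
    exact (splitting_parameter_ne_zero h3 hω hu0 hu1 hAu).1 this
  · have := congrArg (algebraMap K F) h
    simp only [map_add, map_sub, map_mul, map_pow, map_ofNat, map_zero, ha] at this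
    exact (splitting_parameter_ne_zero h3 hω hu0 hu1 hAu).2 this
  · intro i j hij
    have hXij : X i = X j := by rw [← hx, ← hx]; exact congrArg _ hij
    have hXne : X j + ω ^ 2 ≠ 0 := fun h => sub_sq_ne_zero h3 hω (by
      linear_combination -(1 - u * T j) * h + hXu j)
    have hTij : T i = T j := by
      have hi := hXu i
      rw [hXij] at hi
      apply mul_left_cancel₀ (mul_ne_zero hu0 hXne)
      linear_combination hXu j - hi
    have hrij : ω ^ (i : ℕ) = ω ^ (j : ℕ) := by
      simp only [T] at hTij
      rw [div_eq_div_iff (hrd i) (hrd j)] at hTij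
      apply mul_left_cancel₀ (mul_ne_zero h2 hr0)
      linear_combination -hTij
    have hω1 : ω ≠ 1 := fun h => h3 (by rw [h] at hω; linear_combination hω)
    have hω2 : ω ^ 2 ≠ 1 := fun h => hω1 (by linear_combination hω3 - ω * h)
    have hω12 := sub_ne_zero.1 (sub_sq_ne_zero h3 hω)
    fin_cases i <;> fin_cases j <;> first
      | rfl
      | exact absurd ((pow_zero ω).symm.trans (hrij.trans (pow_one ω))).symm hω1
      | exact absurd ((pow_one ω).symm.trans (hrij.trans (pow_zero ω))) hω1
      | exact absurd ((pow_zero ω).symm.trans hrij).symm hω2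
      | exact absurd (hrij.trans (pow_zero ω)) hω2
      | exact absurd ((pow_one ω).symm.trans hrij) hω12
      | exact absurd (hrij.trans (pow_one ω)).symm hω12
  · apply hinj
    simp only [map_add, map_sub, map_mul, map_pow, map_one, map_ofNat, ha, hx]
    exact splitting_parameter_identity h3 hω hu1 hu2 (hT i) hAu (hXu i)

end Descent

open Polynomial in
theorem FiniteField.exists_algebraMap_eq_of_pow_card_eq {K F : Type*} [Field K] [Fintype K]
    [Field F] [Algebra K F] {x : F} (hx : x ^ Fintype.card K = x) :
    ∃ k, algebraMap K F k = x := by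
  classical
  by_contra! h
  have hmem : x ∉ (Finset.univ : Finset K).image (algebraMap K F) := by simpa using h
  have hcard : (insert x ((Finset.univ : Finset K).image (algebraMap K F))).card =
      Fintype.card K + 1 := by
    rw [Finset.card_insert_of_notMem hmem,
      Finset.card_image_of_injective _ (algebraMap K F).injective, Finset.card_univ]
  have hd := FiniteField.X_pow_card_sub_X_natDegree_eq F (Fintype.one_lt_card (α := K))
  refine FiniteField.X_pow_card_sub_X_ne_zero F (Fintype.one_lt_card (α := K))
    (eq_zero_of_natDegree_lt_card_of_eval_eq_zero' _
      (insert x ((Finset.univ : Finset K).image (algebraMap K F))) (fun y hy => ?_) (by omega))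
  rcases Finset.mem_insert.1 hy with rfl | hy
  · simp [hx]
  · obtain ⟨k, -, rfl⟩ := Finset.mem_image.1 hy
    simp [← map_pow, FiniteField.pow_card]

/-- Take `σ` to be the `q`-Frobenius. If `q = 3 n + 1`, then `ω` is fixed, and `s = r^3` with `r` in
`K` amounts to `s^n = 1`. If `q + 1 = 3 n`, then `σ` swaps `ω` and `ω^2`, the twisted elements are
those with `y^(q+1) = -1`, and their cubes satisfy `s^n = -1`. Here `n` is even because `q` is odd;
it is too small for the polynomial argument exactly when `q` is 5, 7 or 13. -/
theorem exists_splitting_parameter_of_isAlgClosed {K : Type*} (F : Type*) [Field K] [Fintype K]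
    [Field F] [Algebra K F] [IsAlgClosed F] (h2 : (2 : K) ≠ 0)
    (h3 : (3 : K) ≠ 0) (hodd : Odd (Fintype.card K)) (hq3 : ¬3 ∣ Fintype.card K)
    (h5 : Fintype.card K ≠ 5) (h7 : Fintype.card K ≠ 7) (h13 : Fintype.card K ≠ 13) :
    ∃ a : K, (∀ z, z ^ 3 - a * z ^ 2 + (a - 3) * z + 1 ≠ 0) ∧ 2 * a - 3 ≠ 0 ∧
      a ^ 2 - 3 * a + 9 ≠ 0 ∧ ∃ x : Fin 3 → K, x.Injective ∧
        ∀ i, (2 * a - 3) * (x i ^ 3 - a * x i ^ 2 + (a - 3) * x i + 1) = a ^ 2 - 3 * a + 9 := by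
  have h2F : (2 : F) ≠ 0 := by
    have := (map_ne_zero (algebraMap K F)).2 h2
    rwa [map_ofNat] at this
  have h3F : (3 : F) ≠ 0 := by
    have := (map_ne_zero (algebraMap K F)).2 h3
    rwa [map_ofNat] at this
  obtain ⟨ω, hω⟩ : ∃ ω : F, ω ^ 2 + ω + 1 = 0 := by
    obtain ⟨δ, hδ⟩ := IsAlgClosed.exists_pow_nat_eq (-3 : F) (n := 2) (by norm_num)
    refine ⟨(δ - 1) / 2, ?_⟩
    field_simp
    linear_combination hδ
  have hω3 : ω ^ 3 = 1 := by linear_combination (ω - 1) * hω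
  set q := Fintype.card K with hq
  have hq0 : (q : F) = 0 := by
    rw [← map_natCast (algebraMap K F), hq, Nat.cast_card_eq_zero, map_zero]
  have hq1 : 1 < q := Fintype.one_lt_card
  let σ : F →+* F := (FiniteField.frobeniusAlgHom K F : F →+* F)
  have hσ (x : F) : σ x = x ^ q := rfl
  have hcube (n : ℕ) (y : F) : y ^ (3 * n) = (y ^ 3) ^ n := pow_mul _ _ _
  have hmod : q % 3 = 1 ∨ q % 3 = 2 := by omega
  have key (s r : F) (hr : r ^ 3 = s) (hs0 : s ≠ 0) (hs1 : s ≠ 1) (hs2 : s ≠ -1) :=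
    exists_splitting_parameter_of_twist (K := K) (r := r) σ
      (fun x hx => FiniteField.exists_algebraMap_eq_of_pow_card_eq hx)
      (fun k => (FiniteField.frobeniusAlgHom K F).commutes k) h2F h3F hω
      (fun h => hs0 (by rw [← hr, h]; norm_num)) (hr.trans_ne hs1) (hr.trans_ne hs2)
  rcases hmod with hmod | hmod
  · obtain ⟨n, hn⟩ : ∃ n, q = 3 * n + 1 := ⟨q / 3, by omega⟩
    have hne : Even n := by
      rw [hn] at hodd
      rcases Nat.even_or_odd n with h | h
      · exact h
      · obtain ⟨a, ha⟩ := h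
        obtain ⟨b, hb⟩ := hodd
        omega
    have hn6 : 6 ≤ n := by
      obtain ⟨m, hm⟩ := hne
      omega
    have h3n : 3 * (n : F) = -1 := by
      rw [hn] at hq0
      push_cast at hq0
      linear_combination hq0
    obtain ⟨s, hs, hs2, hsn⟩ := exists_pow_eq_one_and_add_pow_ne h2F h3F hne hn6 h3n
    obtain ⟨r, hr⟩ := IsAlgClosed.exists_pow_nat_eq s (n := 3) (by norm_num)
    have hs1 : s ≠ 1 := fun h => hs2 (by rw [h, one_pow])
    have hsm : s ≠ -1 := fun h => hs2 (by rw [h]; norm_num)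
    have hd1 : s - 1 ≠ 0 := sub_ne_zero.2 hs1
    have hd2 : s + 1 ≠ 0 := fun h => hsm (by linear_combination h)
    refine key s r hr (fun h => ?_) hs1 hsm (Or.inl ⟨?_, ?_, fun y hy hyu => ?_⟩)
    · rw [h, zero_pow (by omega)] at hs
      exact zero_ne_one hs
    · rw [hσ, hn, pow_succ, hcube, hω3, one_pow, one_mul]
    · rw [hσ, hn, pow_succ, hcube, hr, hs, one_mul]
    · rw [hr] at hyu
      have hy0 : y ≠ 0 := fun h => div_ne_zero hd2 hd1 (by rw [← hyu, h]; norm_num)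
      rw [hσ, hn, pow_succ, hcube, hyu] at hy
      have := mul_right_cancel₀ hy0 (hy.trans (one_mul y).symm)
      rw [div_pow, div_eq_one_iff_eq (pow_ne_zero n hd1)] at this
      exact hsn this
  · obtain ⟨n, hn⟩ : ∃ n, q + 1 = 3 * n := ⟨(q + 1) / 3, by omega⟩
    have hne : Even n := by
      rcases Nat.even_or_odd n with h | h
      · exact h
      · obtain ⟨a, ha⟩ := h
        obtain ⟨b, hb⟩ := hodd
        omega
    have hn4 : 4 ≤ n := by
      obtain ⟨m, hm⟩ := hne
      omega
    have h3n : 3 * (n : F) = 1 := by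
      have := congrArg (Nat.cast (R := F)) hn
      push_cast at this
      linear_combination hq0 - this
    obtain ⟨s, hs, hsn⟩ := exists_pow_eq_neg_one_and_add_pow_ne h2F hne hn4 h3n
    obtain ⟨r, hr⟩ := IsAlgClosed.exists_pow_nat_eq s (n := 3) (by norm_num)
    have hm1 : (-1 : F) ≠ 1 := fun h => h2F (by linear_combination -h)
    have hs1 : s ≠ 1 := fun h => hm1 (by rw [← hs, h, one_pow])
    have hsm : s ≠ -1 := fun h => hm1 (by rw [← hs, h, hne.neg_one_pow])
    have hd1 : s - 1 ≠ 0 := sub_ne_zero.2 hs1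
    have hd2 : s + 1 ≠ 0 := fun h => hsm (by linear_combination h)
    have hs0 : s ≠ 0 := fun h => by
      rw [h, zero_pow (by omega)] at hs
      exact one_ne_zero (neg_eq_zero.1 hs.symm)
    have hr0 : r ≠ 0 := fun h => hs0 (by rw [← hr, h]; norm_num)
    refine key s r hr hs0 hs1 hsm (Or.inr ⟨?_, ?_, fun y hy hyu => ?_⟩)
    · have hq' : q = 3 * (q / 3) + 2 := by omega
      rw [hσ, hq', pow_add, hcube, hω3, one_pow, one_mul]
    · rw [hσ]
      apply mul_right_cancel₀ hr0
      rw [← pow_succ, hn, hcube, hr, hs, neg_mul, inv_mul_cancel₀ hr0]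
    · rw [hr] at hyu
      have hy0 : y ≠ 0 := fun h => div_ne_zero hd2 hd1 (by rw [← hyu, h]; norm_num)
      have : y ^ (q + 1) = -1 := by
        rw [pow_succ, ← hσ, hy, neg_mul, inv_mul_cancel₀ hy0]
      rw [hn, hcube, hyu, div_pow, div_eq_iff (pow_ne_zero n hd1), neg_one_mul] at this
      exact hsn this

theorem exists_splitting_parameter {K : Type*} [Field K] [Fintype K] (h2 : (2 : K) ≠ 0)
    (h3 : (3 : K) ≠ 0) (hodd : Odd (Fintype.card K)) (hq3 : ¬3 ∣ Fintype.card K)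
    (h5 : Fintype.card K ≠ 5) (h7 : Fintype.card K ≠ 7) (h13 : Fintype.card K ≠ 13) :
    ∃ a : K, (∀ z, z ^ 3 - a * z ^ 2 + (a - 3) * z + 1 ≠ 0) ∧ 2 * a - 3 ≠ 0 ∧
      a ^ 2 - 3 * a + 9 ≠ 0 ∧ ∃ x : Fin 3 → K, x.Injective ∧
        ∀ i, (2 * a - 3) * (x i ^ 3 - a * x i ^ 2 + (a - 3) * x i + 1) = a ^ 2 - 3 * a + 9 :=
  exists_splitting_parameter_of_isAlgClosed (AlgebraicClosure K) h2 h3 hodd hq3 h5 h7 h13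

/-! ### Explicit solutions for `q = 5, 7, 13` -/

section SmallFields

variable {K L : Type*} [Field K] [Field L] [Algebra K L] [Fintype K] [DecidableEq K] [Fintype L]

theorem map_cubicNormForm {R S : Type*} [CommRing R] [CommRing S] (f : R →+* S)
    (e₁ e₂ e₃ x y z : R) :
    f (cubicNormForm e₁ e₂ e₃ x y z) =
      cubicNormForm (f e₁) (f e₂) (f e₃) (f x) (f y) (f z) := by
  simp [cubicNormForm, map_ofNat]

/-- Solutions of the norm equations over a prime field, given by coordinates with respect to the
powers of a root of an irreducible cubic. -/
theorem le_copyCount_of_zmod {p : ℕ} (hp : p.Prime) (hK : Fintype.card K = p)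
    (hL : Module.finrank K L = 3) (hcard : 18 ≤ Fintype.card L) (e₁ e₂ e₃ : ZMod p)
    (hroot : ∀ x : ZMod p, x ^ 3 - e₁ * x ^ 2 + e₂ * x - e₃ ≠ 0)
    (h2 : (2 : ZMod p) ≠ 0) (h3 : (3 : ZMod p) ≠ 0)
    (v : Fin 3 → Fin 3 → ZMod p) (b : Fin 6 → Fin 3 → ZMod p) (κ : Fin 3 → ZMod p)
    (hv : v.Injective) (hb : b.Injective) (hκ : ∀ i, κ i ≠ 0)
    (hvb : ∀ i j, cubicNormForm e₁ e₂ e₃ (b j 0 - v i 0) (b j 1 - v i 1) (b j 2 - v i 2) =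
      κ i) :
    ((Fintype.card L : ℤ) - 1) * ((Fintype.card K : ℤ) - 1) * ((Fintype.card L : ℤ) - 24) ≤
      ((projectiveNormGraph K L).copyCount (completeBipartiteGraph (Fin 4) (Fin 6)) : ℤ) := by
  let e : ZMod p ≃+* K := ZMod.ringEquivOfPrime K hp hK
  have hroot : ∀ x : K, x ^ 3 - e e₁ * x ^ 2 + e e₂ * x - e e₃ ≠ 0 := by
    intro x
    obtain ⟨x, rfl⟩ := e.surjective x
    simpa using (map_ne_zero_iff e e.injective).2 (hroot x)
  obtain ⟨c, hc⟩ := exists_root_of_forall_ne_zero hL hroot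
  let g (w : Fin 3 → ZMod p) : L := algebraMap K L (e (w 0)) + algebraMap K L (e (w 1)) * c +
    algebraMap K L (e (w 2)) * c ^ 2
  have hg (w w') : g w - g w' = g (w - w') := by
    simp only [g, Pi.sub_apply, map_sub]
    ring
  have hginj : g.Injective := by
    intro w w' h
    have h0 : g (w - w') = 0 := by rw [← hg, h, sub_self]
    obtain ⟨q0, q1, q2⟩ := eq_zero_of_quadratic_eq_zero hroot hc h0
    rw [map_eq_zero_iff e e.injective] at q0 q1 q2
    rw [← sub_eq_zero]
    funext i
    fin_cases i
    exacts [q0, q1, q2]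
  have hgN (w) : Algebra.norm K (g w) = e (cubicNormForm e₁ e₂ e₃ (w 0) (w 1) (w 2)) := by
    rw [norm_eq_cubicNormForm hL hroot hc]
    exact (map_cubicNormForm (e : ZMod p →+* K) e₁ e₂ e₃ (w 0) (w 1) (w 2)).symm
  have hne {n : ZMod p} (hn : n ≠ 0) : algebraMap K L (e n) ≠ 0 :=
    (map_ne_zero (algebraMap K L)).2 ((map_ne_zero_iff e e.injective).2 hn)
  refine le_copyCount_of_norm_sub_eq (v := fun i => g (v i)) (b := fun j => g (b j))
    (κ := fun i => e (κ i)) ?_ ?_ hcard (hginj.comp hv) (hginj.comp hb)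
    (fun i => (map_ne_zero_iff e e.injective).2 (hκ i)) fun i j => ?_
  · simpa only [map_ofNat] using hne h2
  · simpa only [map_ofNat] using hne h3
  · rw [hg, hgN, ← hvb i j]
    rfl

/-- Coordinates refer to a root of `X^3 + X^2 + 1`; the last `decide` checks all 18 norms. -/
theorem le_copyCount_of_card_eq_five (hK : Fintype.card K = 5) (hL : Module.finrank K L = 3)
    (hcard : 18 ≤ Fintype.card L) :
    ((Fintype.card L : ℤ) - 1) * ((Fintype.card K : ℤ) - 1) * ((Fintype.card L : ℤ) - 24) ≤
      ((projectiveNormGraph K L).copyCount (completeBipartiteGraph (Fin 4) (Fin 6)) : ℤ) :=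
  le_copyCount_of_zmod (by norm_num) hK hL hcard (-1) 0 (-1) (by decide) (by decide) (by decide)
    ![![0, 0, 0], ![1, 0, 0], ![0, 0, 3]]
    ![![0, 2, 2], ![0, 3, 1], ![1, 0, 2], ![1, 2, 2], ![2, 2, 3], ![4, 3, 1]]
    ![3, 3, 2] (by decide) (by decide) (by decide) (by unfold cubicNormForm; decide)

theorem le_copyCount_of_card_eq_seven (hK : Fintype.card K = 7) (hL : Module.finrank K L = 3)
    (hcard : 18 ≤ Fintype.card L) :
    ((Fintype.card L : ℤ) - 1) * ((Fintype.card K : ℤ) - 1) * ((Fintype.card L : ℤ) - 24) ≤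
      ((projectiveNormGraph K L).copyCount (completeBipartiteGraph (Fin 4) (Fin 6)) : ℤ) :=
  le_copyCount_of_zmod (by norm_num) hK hL hcard (-1) 0 (-1) (by decide) (by decide) (by decide)
    ![![0, 0, 0], ![1, 0, 0], ![0, 1, 2]]
    ![![0, 0, 1], ![0, 2, 2], ![1, 1, 5], ![2, 0, 2], ![3, 5, 1], ![6, 0, 4]]
    ![1, 3, 6] (by decide) (by decide) (by decide) (by unfold cubicNormForm; decide)

theorem le_copyCount_of_card_eq_thirteen (hK : Fintype.card K = 13)
    (hL : Module.finrank K L = 3) (hcard : 18 ≤ Fintype.card L) :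
    ((Fintype.card L : ℤ) - 1) * ((Fintype.card K : ℤ) - 1) * ((Fintype.card L : ℤ) - 24) ≤
      ((projectiveNormGraph K L).copyCount (completeBipartiteGraph (Fin 4) (Fin 6)) : ℤ) :=
  le_copyCount_of_zmod (by norm_num) hK hL hcard 1 0 (-1) (by decide) (by decide) (by decide)
    ![![0, 0, 0], ![1, 0, 0], ![0, 0, 1]]
    ![![0, 10, 10], ![1, 3, 5], ![5, 3, 10], ![7, 7, 3], ![9, 8, 9], ![9, 11, 3]]
    ![1, 1, 12] (by decide) (by decide) (by decide) (by unfold cubicNormForm; decide)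

end SmallFields

/-! ### Assembly and asymptotics -/

theorem le_copyCount_projectiveNormGraph {K L : Type*} [Field K] [Field L] [Algebra K L]
    [Fintype K] [DecidableEq K] [Fintype L] (h2 : (2 : K) ≠ 0) (h3 : (3 : K) ≠ 0)
    (hodd : Odd (Fintype.card K)) (hq3 : ¬3 ∣ Fintype.card K) (hL : Module.finrank K L = 3)
    (hcard : 18 ≤ Fintype.card L) :
    ((Fintype.card L : ℤ) - 1) * ((Fintype.card K : ℤ) - 1) * ((Fintype.card L : ℤ) - 24) ≤
      ((projectiveNormGraph K L).copyCount (completeBipartiteGraph (Fin 4) (Fin 6)) : ℤ) := by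
  by_cases h5 : Fintype.card K = 5
  · exact le_copyCount_of_card_eq_five h5 hL hcard
  by_cases h7 : Fintype.card K = 7
  · exact le_copyCount_of_card_eq_seven h7 hL hcard
  by_cases h13 : Fintype.card K = 13
  · exact le_copyCount_of_card_eq_thirteen h13 hL hcard
  obtain ⟨a, ha, ha2, hD, x, hx, hxa⟩ := exists_splitting_parameter h2 h3 hodd hq3 h5 h7 h13
  -- With `s = -3`, `t = a` the involution exchanges infinity and `a / 3`, the mean of the roots.
  -- Then `s^2 + s t + t^2` is `a^2 - 3 a + 9`, the norm of the denominator is `-(2 a - 3)(a^2 - 3 a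
  -- + 9)`, and the common norm is the stated `T`.
  refine le_copyCount_of_simplestCubic (a := a) (s := -3) (t := a)
    (T := (a ^ 2 - 3 * a + 9) / (2 * a - 3)) h2 h3 hcard hL ha ?_ ?_ (div_ne_zero hD ha2) ?_ hx ?_
  · convert hD using 1
    ring
  · have : cubicNormForm a (a - 3) (-1) a (-3) 0 =
        -((2 * a - 3) * (a ^ 2 - 3 * a + 9)) := by
      rw [cubicNormForm]
      ring
    rw [this]
    exact neg_ne_zero.2 (mul_ne_zero ha2 hD)
  · rw [div_mul_eq_mul_div, div_eq_iff ha2, cubicNormForm, cubicNormForm]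
    ring
  · intro i
    rw [eq_div_iff ha2, ← hxa i]
    ring

/-- For a power `q = p ^ k` of a prime `p ≠ 2, 3`, the graph `NG(q, 4)` has at least
`(q^3 - 1)(q - 1)(q^3 - 24)` subgraphs isomorphic to `K_{4,6}`, and this bound is
`(1 + o(1)) q^7`. -/
theorem theorem2 :
    (∀ (p k q : ℕ) (_hp : p.Prime) (_hk : 1 ≤ k) (_hq : q = p ^ k) (_h2 : p ≠ 2) (_h3 : p ≠ 3)
      (K : Type*) (L : Type*) [Field K] [Fintype K] [DecidableEq K] [Field L] [Fintype L]
      [Algebra K L] (_hK : Fintype.card K = q) (_hL : Module.finrank K L = 3),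
      ((q : ℤ) ^ 3 - 1) * ((q : ℤ) - 1) * ((q : ℤ) ^ 3 - 24) ≤
        ((projectiveNormGraph K L).copyCount (completeBipartiteGraph (Fin 4) (Fin 6)) : ℤ)) ∧
    Asymptotics.IsEquivalent Filter.atTop
      (fun q : ℕ => ((q : ℝ) ^ 3 - 1) * ((q : ℝ) - 1) * ((q : ℝ) ^ 3 - 24))
      (fun q : ℕ => (q : ℝ) ^ 7) := by
  constructor
  · intro p k q hp hk hq h2 h3 K L _ _ _ _ _ _ hK hL
    have hcast {n : ℕ} (hn : n.Prime) (hpn : p ≠ n) : (n : K) ≠ 0 := fun h => by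
      obtain ⟨m, hm⟩ := CharP.exists K
      obtain ⟨j, hmp, hj⟩ := FiniteField.card K m
      have h1 : m = n := (Nat.prime_dvd_prime_iff_eq hmp hn).1 ((CharP.cast_eq_zero_iff K m n).1 h)
      have h2 : m ∣ p := hmp.dvd_of_dvd_pow (n := k) (by
        rw [← hq, ← hK, hj]
        exact dvd_pow_self m j.ne_zero)
      exact hpn (((Nat.prime_dvd_prime_iff_eq hmp hp).1 h2).symm.trans h1)
    have hodd : Odd (Fintype.card K) := by
      rw [hK, hq]
      exact (hp.odd_of_ne_two h2).pow
    have hq3 : ¬3 ∣ Fintype.card K := fun h => by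
      rw [hK, hq] at h
      exact h3 ((Nat.prime_dvd_prime_iff_eq Nat.prime_three hp).1
        (Nat.prime_three.dvd_of_dvd_pow h)).symm
    have hLcard : Fintype.card L = q ^ 3 := by
      rw [Module.card_eq_pow_finrank (K := K), hK, hL]
    have hq1 : 1 < q := hK ▸ Fintype.one_lt_card
    have h18 : 18 ≤ Fintype.card L := by
      have : 3 ≤ q := by
        rw [hK] at hodd
        obtain ⟨m, hm⟩ := hodd
        omega
      rw [hLcard]
      exact le_trans (by norm_num) (Nat.pow_le_pow_left this 3)
    have := le_copyCount_projectiveNormGraph (K := K) (L := L)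
      (by simpa using hcast Nat.prime_two h2) (by simpa using hcast Nat.prime_three h3)
      hodd hq3 hL h18
    rw [hLcard, hK] at this
    exact_mod_cast this
  · rw [Asymptotics.isEquivalent_iff_tendsto_one]
    · have h0 : Filter.Tendsto (fun q : ℕ => ((q : ℝ))⁻¹) Filter.atTop (nhds 0) :=
        tendsto_inv_atTop_nhds_zero_nat
      have h : Filter.Tendsto (fun q : ℕ => (1 - ((q : ℝ)⁻¹) ^ 3) * (1 - (q : ℝ)⁻¹) *
          (1 - 24 * ((q : ℝ)⁻¹) ^ 3)) Filter.atTop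
          (nhds ((1 - 0 ^ 3) * (1 - 0) * (1 - 24 * 0 ^ 3))) :=
        (((h0.pow 3).const_sub 1).mul (h0.const_sub 1)).mul (((h0.pow 3).const_mul 24).const_sub 1)
      norm_num at h
      refine h.congr' ?_
      filter_upwards [Filter.eventually_gt_atTop 0] with q hq
      have : (q : ℝ) ≠ 0 := by positivity
      simp only [Pi.div_apply]
      field_simp
    · filter_upwards [Filter.eventually_gt_atTop 0] with q hq
      have : (q : ℝ) ≠ 0 := by positivity
      positivity
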